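/- **Setting.** Let $\mathbb F_q$ be a finite field with $q$ elements, $d\ge 5$ an odd integer, $m$ a positive divisor of $d$, $p\in\mathbb F_q[X]$ monic irreducible of degree $d/m$, $\alpha\in\mathbb F_q^\times$, $f=\alpha p^m$, and $h\in\mathbb F_q[X]$ a nonzero polynomial of degree at most $(d-1)/2$ not divisible by $p$, such that the affine curve $\xi=Y^2+h(X)Y-f(X)=0$ is smooth. Put $\mathbf A=\mathbb F_q[X][Y]/(\xi)$ and $\mathfrak p=\langle p(\overline X),\overline Y\rangle$. Let $L$ be an extension of $\mathbb F_q$ of degree $d$ with an $\mathbb F_q$-algebra morphism $\gamma:\mathbf A\to L$ of kernel $\mathfrak p$, and put $w=\gamma(\overline X)$. Let $L\{\tau\}$ be the ring of Ore polynomials, with $\tau a=a^q\tau$ for $a\in L$. The right greatest common divisor (rgcd) of two Ore polynomials is the monic generator of the left ideal that they generate. **Algorithm GroupAction.** The input consists of $j\in L$, the $j$-invariant $g^{q+1}/\Delta$ of a Drinfeld $\mathbf A$-module $\phi$ of rank $1$ over $(L,\gamma)$ with $\phi_{\overline X}=\Delta\tau^2+g\tau+w$, and of Mumford coordinates $(u,v)\in\mathbb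 F_q[X]^2$, i.e. $u$ is monic of degree at most $(d-1)/2$, $\deg v<\deg u$, and $u$ divides $\xi(X,v(X))$. The algorithm computes successively $$\widetilde u=u(j^{-1}\tau^2+\tau+w),\qquad \widetilde v=v(j^{-1}\tau^2+\tau+w),\qquad \iota=\sum_k\iota_k\tau^k=\mathrm{rgcd}(\widetilde u,\ \tau^d-\widetilde v),$$ $$\widehat g=\iota_0^{-q}\bigl(\iota_0+\iota_1(w^q-w)\bigr),\qquad \widehat\Delta=j^{-q^{\deg_\tau\iota}},\qquad \widehat g^{\,q+1}/\widehat\Delta,$$ and returns the last value (with the convention $x/0=0$ for divisions in $L$). **Cost model.** A program has finitely many natural-number variables, on which it can assign constants, add, subtract (truncated at $0$) and compare, and finitely many arrays of elements of $L$ addressed by these variables. It can access $L$ only through $+,-,\times,/$, copies, the constants $0,1$ and zero tests; it is composed by sequencing, conditionals and while loops. Every executed instruction, in particular every arithmetic operation in $L$, and every test counts as one step. A real number $\omega$ is a feasible exponent for matrix multiplication over $\mathbb F_q$ if for every $n\ge1$ the product of two $n\times n$ matrices over $\mathbb F_q$ can be computed by a straight-line program with $O(n^\omega)$ arithmetic operations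 in $\mathbb F_q$. **Proposition.** There are one program and one integer $k\ge0$ such that for every prime power $q$ and every feasible exponent $\omega$ for matrix multiplication over $\mathbb F_q$ there is a constant $c$, depending only on $q$ and $\omega$, such that for all data as above the following holds. Given $q$, $d$, $w$, $j$ and the coefficients of $u$ and $v$, the program carries out GroupAction, i.e. it halts with all the values $\widetilde u,\widetilde v,\iota,\widehat g,\widehat\Delta,\widehat g^{\,q+1}/\widehat\Delta$ in memory, after at most $$c\,d^{\frac{\omega+3}{2}}(\log d)^k$$ steps. In particular GroupAction requires $\widetilde O_q\bigl(d^{\frac{\omega+3}{2}}\bigr)$ arithmetic operations in $L$. -/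

import Mathlib

/-! ## Ore polynomials over an extension of a finite field -/

section Ore

variable (F L : Type*) [Field F] [Fintype F] [Field L] [Algebra F L]

theorem frobeniusPow_apply (n : ℕ) (x : L) :
    ((FiniteField.frobeniusAlgHom F L) ^ n) x = x ^ (Fintype.card F ^ n) := by
  rw [AlgHom.coe_pow, FiniteField.coe_frobeniusAlgHom, pow_iterate]

/-- The action of `ℕ` on `L` by powers of the Frobenius `x ↦ x ^ q`, where `q = #F`. -/
@[reducible] noncomputable def frobeniusAction : MulSemiringAction (Multiplicative ℕ) L where
  smul n x := ((FiniteField.frobeniusAlgHom F L) ^ n.toAdd) x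
  one_smul _ := rfl
  mul_smul m n x := by
    change ((FiniteField.frobeniusAlgHom F L) ^ (m.toAdd + n.toAdd)) x = _
    rw [pow_add]
    rfl
  smul_zero n := map_zero _
  smul_add n := map_add _
  smul_one n := map_one _
  smul_mul n := map_mul _

theorem frobeniusAction_smul (n : ℕ) (x : L) :
    (frobeniusAction F L).toSMul.smul (Multiplicative.ofAdd n) x = x ^ (Fintype.card F ^ n) :=
  frobeniusPow_apply F L n x

/-- The ring `L{τ}` of Ore polynomials `∑ aᵢ τ^i` with `τ a = a ^ q τ`, where `q = #F`. -/
def OrePoly (F L : Type*) [Field F] [Fintype F] [Field L] [Algebra F L] : Type _ :=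
  SkewPolynomial L

noncomputable instance OrePoly.instRing : Ring (OrePoly F L) :=
  letI := frobeniusAction F L
  inferInstanceAs (Ring (SkewPolynomial L))

namespace OrePoly

variable {F L}

/-- The coefficient of `τ ^ n`. -/
def coeff (P : OrePoly F L) (n : ℕ) : L := SkewPolynomial.coeff P n

/-- The `τ`-degree (with value `0` at `0`). -/
def tauDegree (P : OrePoly F L) : ℕ := (SkewPolynomial.support P).sup id

/-- The leading coefficient is `1`. -/
def Monic (P : OrePoly F L) : Prop := P.coeff P.tauDegree = 1

variable (F L)

/-- The inclusion of the constants `L → L{τ}`. -/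
noncomputable def C : L →+* OrePoly F L :=
  letI := frobeniusAction F L
  (SkewPolynomial.CRingHom : L →+* SkewPolynomial L)

/-- The variable `τ`. -/
noncomputable def tau : OrePoly F L := (SkewPolynomial.X : SkewPolynomial L)

variable {F L}

theorem ext' {P Q : OrePoly F L} (h : ∀ n, P.coeff n = Q.coeff n) : P = Q :=
  SkewPolynomial.ext h

theorem coeff_C_mul_tau_pow (a : L) (m n : ℕ) :
    (C F L a * tau F L ^ m).coeff n = if m = n then a else 0 := by
  let := frobeniusAction F L
  have key : SkewPolynomial.coeff
      ((SkewPolynomial.C a : SkewPolynomial L) * (SkewPolynomial.X : SkewPolynomial L) ^ m) n =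
        if m = n then a else 0 := by
    rw [SkewPolynomial.C_mul_X_pow_eq_monomial, SkewPolynomial.coeff_monomial]
  exact key

theorem tau_mul_C (a : L) : tau F L * C F L a = C F L (a ^ Fintype.card F) * tau F L := by
  let := frobeniusAction F L
  have h : (Multiplicative.ofAdd 1) • a = a ^ Fintype.card F := by
    have h' := frobeniusAction_smul F L 1 a
    rw [pow_one] at h'
    exact h'
  have key : (SkewPolynomial.X : SkewPolynomial L) * (SkewPolynomial.C a : SkewPolynomial L) =
      (SkewPolynomial.C (a ^ Fintype.card F) : SkewPolynomial L) * SkewPolynomial.X := by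
    rw [SkewPolynomial.C_mul_X_eq_monomial, ← SkewPolynomial.monomial_one_one_eq_X,
      SkewPolynomial.monomial_mul_C, one_mul, SkewPolynomial.φ_iterate_apply, h]
  exact key

theorem C_algebraMap_commutes (c : F) (P : OrePoly F L) :
    C F L (algebraMap F L c) * P = P * C F L (algebraMap F L c) := by
  let := frobeniusAction F L
  have key : ∀ Q : SkewPolynomial L,
      (SkewPolynomial.C (algebraMap F L c) : SkewPolynomial L) * Q =
        Q * SkewPolynomial.C (algebraMap F L c) := by
    intro Q
    induction Q using SkewPolynomial.induction with
    | h0 => rw [mul_zero, zero_mul]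
    | ha n r Q _ _ ih =>
      have h : (Multiplicative.ofAdd n) • (algebraMap F L c) = algebraMap F L c := by
        have h' := frobeniusAction_smul F L n (algebraMap F L c)
        rw [← map_pow, FiniteField.pow_card_pow] at h'
        exact h'
      rw [mul_add, add_mul, ih, SkewPolynomial.C_mul_monomial, SkewPolynomial.monomial_mul_C,
        SkewPolynomial.φ_iterate_apply, h, mul_comm]
  exact key P

noncomputable instance instAlgebra : Algebra F (OrePoly F L) :=
  ((C F L).comp (algebraMap F L)).toAlgebra' C_algebraMap_commutes

/-- `g` is the right greatest common divisor of `S`: the monic generator of the left ideal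
generated by `S` (`Ideal` means left ideal). -/
def IsRGCD (S : Set (OrePoly F L)) (g : OrePoly F L) : Prop :=
  g.Monic ∧ Ideal.span S = Ideal.span {g}

end OrePoly

/-! ## Drinfeld modules -/

variable {F L}

/-- Drinfeld `A`-modules over `(L, γ)`. -/
structure DrinfeldModule {A : Type*} [CommRing A] [Algebra F A] (γ : A →ₐ[F] L) where
  toAlgHom : A →ₐ[F] OrePoly F L
  coeff_zero : ∀ a, (toAlgHom a).coeff 0 = γ a
  exists_pos : ∃ a, 0 < (toAlgHom a).tauDegree

/-- `φ` has rank `r`: `deg_τ φ_a = r * deg a` for `a ≠ 0`, where `q ^ deg a = #(A / aA)`. -/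
def DrinfeldModule.HasRank {A : Type*} [CommRing A] [Algebra F A] {γ : A →ₐ[F] L}
    (φ : DrinfeldModule γ) (r : ℕ) : Prop :=
  ∀ a : A, a ≠ 0 →
    Fintype.card F ^ (φ.toAlgHom a).tauDegree = Nat.card (A ⧸ Ideal.span {a}) ^ r

end Ore

/-! ## The hyperelliptic curve -/

section Curve

open Polynomial

variable {F : Type*} [Field F]

/-- `ξ = Y² + h(X) Y - f(X)` in `F[X][Y]`. -/
noncomputable def xiPoly (h f : F[X]) : F[X][X] := X ^ 2 + C h * X - C f

/-- The coordinate ring `F[X][Y] / (ξ)`. -/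
abbrev CoordRing (h f : F[X]) : Type _ := AdjoinRoot (xiPoly h f)

/-- The class of a polynomial in `X`. -/
noncomputable def CoordRing.ofX {h f : F[X]} (a : F[X]) : CoordRing h f :=
  AdjoinRoot.of (xiPoly h f) a

/-- The class of `Y`. -/
noncomputable def CoordRing.Y {h f : F[X]} : CoordRing h f := AdjoinRoot.root (xiPoly h f)

/-- The affine curve `y² + h(x) y = f(x)` has no singular point over the algebraic closure. -/
def IsSmoothAffine (h f : F[X]) : Prop :=
  ∀ x y : AlgebraicClosure F,
    y ^ 2 + aeval x h * y - aeval x f = 0 →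
      ¬ (2 * y + aeval x h = 0 ∧ aeval x (derivative h) * y - aeval x (derivative f) = 0)

/-- The data `d`, `m`, `α`, `p`, `h` defining the imaginary hyperelliptic curve
`Y² + h(X) Y = α p(X)^m`. -/
structure IsCurveDatum (d m : ℕ) (α : F) (p h : F[X]) : Prop where
  five_le : 5 ≤ d
  odd : Odd d
  natDegree_p_mul : p.natDegree * m = d
  monic_p : p.Monic
  irreducible_p : Irreducible p
  alpha_ne : α ≠ 0
  h_ne : h ≠ 0
  natDegree_h : h.natDegree ≤ (d - 1) / 2
  not_dvd : ¬ p ∣ h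
  smooth : IsSmoothAffine h (C α * p ^ m)

/-- Mumford coordinates `(u, v)` on the curve `Y² + h(X) Y = f(X)` of genus `(d - 1) / 2`. -/
structure IsMumford (d : ℕ) (h f u v : F[X]) : Prop where
  monic : u.Monic
  natDegree_le : u.natDegree ≤ (d - 1) / 2
  degree_lt : v.degree < u.degree
  dvd : u ∣ (xiPoly h f).eval v

variable [Fintype F] {L : Type*} [Field L] [Algebra F L] {h f : F[X]}

/-- `j` is the `j`-invariant `g ^ (q + 1) / Δ` of some rank one Drinfeld module over `L` for the
coordinate ring, where `φ_X = Δ τ² + g τ + γ(X)`. -/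
def IsJInvariant (γ : CoordRing h f →ₐ[F] L) (j : L) : Prop :=
  ∃ φ : DrinfeldModule γ, φ.HasRank 1 ∧
    j = (φ.toAlgHom (CoordRing.ofX X)).coeff 1 ^ (Fintype.card F + 1) /
      (φ.toAlgHom (CoordRing.ofX X)).coeff 2

end Curve

/-! ## The algorithm -/

section Algorithm

variable (F L : Type*) [Field F] [Fintype F] [Field L] [Algebra F L]

/-- The values of the variables of `GroupAction` during a run. -/
structure GroupActionRun where
  uTilde : OrePoly F L
  vTilde : OrePoly F L
  iota : OrePoly F L
  gHat : L
  deltaHat : L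
  result : L

variable {F L}

/-- The Ore polynomial `j⁻¹ τ² + τ + w`. -/
noncomputable def phiX (j w : L) : OrePoly F L :=
  OrePoly.C F L j⁻¹ * OrePoly.tau F L ^ 2 + OrePoly.tau F L + OrePoly.C F L w

/-- `T` holds the values that the successive lines of `GroupAction` assign, on the input
`j`, `(u, v)`, over a field `L` of degree `d` over `F`, where `w` is the image of `X` in `L`. -/
structure GroupActionRun.IsRunOn (T : GroupActionRun F L) (d : ℕ) (w j : L)
    (u v : Polynomial F) : Prop where
  uTilde_eq : T.uTilde = Polynomial.aeval (phiX j w) u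
  vTilde_eq : T.vTilde = Polynomial.aeval (phiX j w) v
  iota_eq : OrePoly.IsRGCD {T.uTilde, OrePoly.tau F L ^ d - T.vTilde} T.iota
  gHat_eq : T.gHat = (T.iota.coeff 0 ^ Fintype.card F)⁻¹ *
    (T.iota.coeff 0 + T.iota.coeff 1 * (w ^ Fintype.card F - w))
  deltaHat_eq : T.deltaHat = (j ^ (Fintype.card F ^ T.iota.tauDegree))⁻¹
  result_eq : T.result = T.gHat ^ (Fintype.card F + 1) / T.deltaHat

end Algorithm

/-! ## Programs over a field, and their cost

A program has index variables, holding natural numbers, and arrays of field elements; both are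
named by natural numbers.  An array cell is addressed by an index variable.  The only access to
the field is through arithmetic operations, copies, the constants `0` and `1`, and zero tests. -/

/-- The memory of a program: `idx x` is the value of the index variable `x`, and `val a i` is
the cell `i` of the array `a`. -/
structure Store (K : Type*) where
  idx : ℕ → ℕ
  val : ℕ → ℕ → K

namespace Store

variable {K : Type*}

def setIdx (s : Store K) (x n : ℕ) : Store K :=
  { s with idx := Function.update s.idx x n }

def setVal (s : Store K) (a i : ℕ) (c : K) : Store K :=
  { s with val := Function.update s.val a (Function.update (s.val a) i c) }

/-- The cell of the array `a` that the index variable `x` points to. -/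
def get (s : Store K) (a x : ℕ) : K := s.val a (s.idx x)

end Store

/-- The arithmetic operations of a field (with `x / 0 = 0`). -/
inductive FieldOp
  | add
  | sub
  | mul
  | div

def FieldOp.eval {K : Type*} [Field K] : FieldOp → K → K → K
  | .add, x, y => x + y
  | .sub, x, y => x - y
  | .mul, x, y => x * y
  | .div, x, y => x / y

/-- Programs.  In the comments, `x`, `y`, `z` are index variables and `a`, `b`, `c` arrays. -/
inductive Prog
  /-- do nothing -/
  | skip
  /-- `x := n` -/
  | idxConst (x n : ℕ)
  /-- `x := y + z` -/
  | idxAdd (x y z : ℕ)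
  /-- `x := y - z`, truncated at `0` -/
  | idxSub (x y z : ℕ)
  /-- `a[x] := 0` -/
  | zero (a x : ℕ)
  /-- `a[x] := 1` -/
  | one (a x : ℕ)
  /-- `a[x] := b[y]` -/
  | copy (a x b y : ℕ)
  /-- `a[x] := b[y] op c[z]` -/
  | arith (op : FieldOp) (a x b y c z : ℕ)
  /-- first `P`, then `Q` -/
  | seq (P Q : Prog)
  /-- if `x < y` then `P` else `Q` -/
  | ifLt (x y : ℕ) (P Q : Prog)
  /-- if `a[x] = 0` then `P` else `Q` -/
  | ifZero (a x : ℕ) (P Q : Prog)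
  /-- while `x < y` do `P` -/
  | whileLt (x y : ℕ) (P : Prog)

/-- `Exec P s s' t`: started in the memory `s`, the program `P` halts with the memory `s'` after
exactly `t` elementary steps.  Every instruction (thus every arithmetic operation) and every
evaluation of a test is one step. -/
inductive Exec {K : Type*} [Field K] : Prog → Store K → Store K → ℕ → Prop
  | skip (s : Store K) : Exec .skip s s 1
  | idxConst (s : Store K) (x n : ℕ) : Exec (.idxConst x n) s (s.setIdx x n) 1
  | idxAdd (s : Store K) (x y z : ℕ) :
      Exec (.idxAdd x y z) s (s.setIdx x (s.idx y + s.idx z)) 1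
  | idxSub (s : Store K) (x y z : ℕ) :
      Exec (.idxSub x y z) s (s.setIdx x (s.idx y - s.idx z)) 1
  | zero (s : Store K) (a x : ℕ) : Exec (.zero a x) s (s.setVal a (s.idx x) 0) 1
  | one (s : Store K) (a x : ℕ) : Exec (.one a x) s (s.setVal a (s.idx x) 1) 1
  | copy (s : Store K) (a x b y : ℕ) :
      Exec (.copy a x b y) s (s.setVal a (s.idx x) (s.get b y)) 1
  | arith (s : Store K) (op : FieldOp) (a x b y c z : ℕ) :
      Exec (.arith op a x b y c z) s
        (s.setVal a (s.idx x) (op.eval (s.get b y) (s.get c z))) 1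
  | seq {P Q : Prog} {s s' s'' : Store K} {t t' : ℕ} :
      Exec P s s' t → Exec Q s' s'' t' → Exec (.seq P Q) s s'' (t + t')
  | ifLt_true {x y : ℕ} {P Q : Prog} {s s' : Store K} {t : ℕ} :
      s.idx x < s.idx y → Exec P s s' t → Exec (.ifLt x y P Q) s s' (t + 1)
  | ifLt_false {x y : ℕ} {P Q : Prog} {s s' : Store K} {t : ℕ} :
      ¬ s.idx x < s.idx y → Exec Q s s' t → Exec (.ifLt x y P Q) s s' (t + 1)
  | ifZero_true {a x : ℕ} {P Q : Prog} {s s' : Store K} {t : ℕ} :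
      s.get a x = 0 → Exec P s s' t → Exec (.ifZero a x P Q) s s' (t + 1)
  | ifZero_false {a x : ℕ} {P Q : Prog} {s s' : Store K} {t : ℕ} :
      s.get a x ≠ 0 → Exec Q s s' t → Exec (.ifZero a x P Q) s s' (t + 1)
  | while_done {x y : ℕ} {P : Prog} {s : Store K} :
      ¬ s.idx x < s.idx y → Exec (.whileLt x y P) s s 1
  | while_step {x y : ℕ} {P : Prog} {s s' s'' : Store K} {t t' : ℕ} :
      s.idx x < s.idx y → Exec P s s' t → Exec (.whileLt x y P) s' s'' t' →
        Exec (.whileLt x y P) s s'' (t + t' + 1)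

section InputOutput

variable {F L : Type*} [Field F] [Fintype F] [Field L] [Algebra F L]

/-- The initial memory: the index variables `0`, `1` hold `q = #F` and `d`, the array `0` holds
`j` and `w`, the arrays `1` and `2` hold the coefficients of `u` and `v`; all else is zero. -/
noncomputable def inputStore (d : ℕ) (w j : L) (u v : Polynomial F) : Store L where
  idx := fun x => if x = 0 then Fintype.card F else if x = 1 then d else 0
  val := fun a i =>
    if a = 0 then (if i = 0 then j else if i = 1 then w else 0)
    else if a = 1 then algebraMap F L (u.coeff i)
    else if a = 2 then algebraMap F L (v.coeff i)
    else 0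

/-- The arrays `3`, `4`, `5` hold the coefficients of the three Ore polynomials of the run, and
the cells `0`, `1`, `2` of the array `6` hold its three field elements. -/
structure Store.Holds (s : Store L) (T : GroupActionRun F L) : Prop where
  uTilde : ∀ i, s.val 3 i = T.uTilde.coeff i
  vTilde : ∀ i, s.val 4 i = T.vTilde.coeff i
  iota : ∀ i, s.val 5 i = T.iota.coeff i
  gHat : s.val 6 0 = T.gHat
  deltaHat : s.val 6 1 = T.deltaHat
  result : s.val 6 2 = T.result

end InputOutput

/-! ## Feasible exponents for matrix multiplication -/

/-- Instructions of straight-line programs over `K`; operands are positions of earlier values. -/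
inductive SLInstr (K : Type*)
  | const (c : K)
  | add (i j : ℕ)
  | sub (i j : ℕ)
  | mul (i j : ℕ)

def SLInstr.eval {K : Type*} [Field K] (l : List K) : SLInstr K → K
  | .const c => c
  | .add i j => l.getD i 0 + l.getD j 0
  | .sub i j => l.getD i 0 - l.getD j 0
  | .mul i j => l.getD i 0 * l.getD j 0

/-- Each instruction appends its value to the list of values computed so far. -/
def runSL {K : Type*} [Field K] : List (SLInstr K) → List K → List K
  | [], l => l
  | c :: cs, l => runSL cs (l ++ [c.eval l])

/-- The entries of a matrix, row by row. -/
def matrixEntries {K : Type*} {n : ℕ} (A : Matrix (Fin n) (Fin n) K) : List K :=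
  List.ofFn fun i : Fin (n * n) => A i.divNat i.modNat

/-- `cs` computes, from the entries of `A` and `B`, values among which are the entries of
`A * B`, at positions independent of `A` and `B`. -/
def MultipliesMatrices {K : Type*} [Field K] (n : ℕ) (cs : List (SLInstr K)) : Prop :=
  ∃ out : Fin n → Fin n → ℕ, ∀ A B : Matrix (Fin n) (Fin n) K, ∀ i k : Fin n,
    (runSL cs (matrixEntries A ++ matrixEntries B)).getD (out i k) 0 = (A * B) i k

/-- `ω` is a feasible exponent for matrix multiplication over `K`: two `n × n` matrices can be
multiplied with `O(n ^ ω)` arithmetic operations in `K`. -/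
def IsFeasibleExponent (K : Type*) [Field K] (ω : ℝ) : Prop :=
  ∃ c : ℝ, ∀ n : ℕ, 1 ≤ n → ∃ cs : List (SLInstr K),
    MultipliesMatrices n cs ∧ (cs.length : ℝ) ≤ c * (n : ℝ) ^ ω

/-! ### Coefficients and lengths of Ore polynomials -/

namespace OrePoly

variable {F L : Type*} [Field F] [Fintype F] [Field L] [Algebra F L]

/-! Elementary dense arithmetic already meets the bound. The `n ^ 2` entries of a matrix product
must appear at `n ^ 2` distinct newly computed positions of a straight-line program, so every
feasible exponent satisfies `2 ≤ ω` (`IsFeasibleExponent.two_le`), and `(ω + 3) / 2` exceeds `2`. It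
therefore suffices to exhibit a program with `O(q d²)` steps; no fast matrix multiplication and no
logarithmic factor is needed.

Ore polynomials are stored as coefficient arrays of length `O(d)`. A `q`-th power is computed by `q`
multiplications, so left multiplication by `τ`, scaling and adding a scalar multiple each cost `O(q
d)` steps. Left multiplication by `φ = j⁻¹ τ² + τ + w` is a fixed number of such operations, and `d`
rounds of it evaluate `u` and `v` simultaneously (`halts_evaluate`). For the right gcd, division by
a monic `B` of degree `b` replaces each term of degree `k ≥ b` using a remainder of `τ ^ k` modulo
the left ideal of `B`; the remainder for `k + 1` is `τ` times the one for `k` minus a multiple of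
`B`, so each degree costs `O(q d)` steps (`halts_reduce`). A Euclidean round costs `O(q d)` times
the degree gap plus a constant, and the two lengths together drop by at least that gap plus one, so
the rounds add up to `O(d)` array operations (`halts_euclid`). The left ideal generated by the pair
is preserved (`span_pair_eq`), and the last nonzero member is monic. The remaining field elements
cost `O(q d)` steps.

Correctness and cost are proved together through `HaltsWith`, which carries a step budget and a
postcondition; `halts_groupAction` assembles the pieces. -/

@[simp] theorem coeff_zero (n : ℕ) : (0 : OrePoly F L).coeff n = 0 := rfl

@[simp] theorem coeff_add (P Q : OrePoly F L) (n : ℕ) :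
    (P + Q).coeff n = P.coeff n + Q.coeff n :=
  SkewPolynomial.coeff_add P Q n

@[simp] theorem coeff_neg (P : OrePoly F L) (n : ℕ) : (-P).coeff n = -P.coeff n :=
  SkewPolynomial.coeff_neg P n

@[simp] theorem coeff_sub (P Q : OrePoly F L) (n : ℕ) :
    (P - Q).coeff n = P.coeff n - Q.coeff n := by
  rw [sub_eq_add_neg, coeff_add, coeff_neg, sub_eq_add_neg]

theorem coeff_tau_pow (m n : ℕ) : (tau F L ^ m).coeff n = if m = n then 1 else 0 := by
  simpa using coeff_C_mul_tau_pow (F := F) (1 : L) m n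

theorem coeff_one (n : ℕ) : (1 : OrePoly F L).coeff n = if 0 = n then 1 else 0 := by
  simpa using coeff_tau_pow (F := F) (L := L) 0 n

/-- Additive induction on Ore polynomials, from the terms `a τ ^ n`. -/
theorem induction_terms {motive : OrePoly F L → Prop} (P : OrePoly F L) (zero : motive 0)
    (add : ∀ P Q, motive P → motive Q → motive (P + Q))
    (term : ∀ a n, motive (C F L a * tau F L ^ n)) : motive P := by
  let := frobeniusAction F L
  have key : ∀ Q : SkewPolynomial L, motive Q := by
    intro Q
    induction Q using SkewPolynomial.induction with
    | h0 => exact zero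
    | ha n r Q _ _ ih =>
      refine add _ _ ?_ ih
      rw [← SkewPolynomial.C_mul_X_pow_eq_monomial]
      exact term r n
  exact key P

@[simp] theorem coeff_C_mul (c : L) (P : OrePoly F L) (n : ℕ) :
    (C F L c * P).coeff n = c * P.coeff n := by
  induction P using induction_terms with
  | zero => simp
  | add P Q hP hQ => rw [mul_add, coeff_add, hP, hQ, coeff_add, mul_add]
  | term a m =>
    rw [← mul_assoc, ← map_mul, coeff_C_mul_tau_pow, coeff_C_mul_tau_pow, mul_ite, mul_zero]

theorem tau_mul_C_mul_tau_pow (a : L) (m : ℕ) :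
    tau F L * (C F L a * tau F L ^ m) = C F L (a ^ Fintype.card F) * tau F L ^ (m + 1) := by
  rw [← mul_assoc, tau_mul_C, mul_assoc, ← pow_succ']

/-- Transferred from additivity of the Frobenius homomorphism over `F`, so the characteristic never
has to be named. -/
theorem card_pow_add (a b : L) :
    (a + b) ^ Fintype.card F = a ^ Fintype.card F + b ^ Fintype.card F := by
  have h := frobeniusPow_apply F L 1
  rw [pow_one, pow_one] at h
  rw [← h, ← h, ← h, map_add]

@[simp] theorem coeff_tau_mul_zero (P : OrePoly F L) : (tau F L * P).coeff 0 = 0 := by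
  induction P using induction_terms with
  | zero => simp
  | add P Q hP hQ => rw [mul_add, coeff_add, hP, hQ, add_zero]
  | term a m => rw [tau_mul_C_mul_tau_pow, coeff_C_mul_tau_pow, if_neg (Nat.succ_ne_zero m)]

@[simp] theorem coeff_tau_mul_succ (P : OrePoly F L) (n : ℕ) :
    (tau F L * P).coeff (n + 1) = P.coeff n ^ Fintype.card F := by
  induction P using induction_terms with
  | zero => simp [Fintype.card_ne_zero]
  | add P Q hP hQ => rw [mul_add, coeff_add, hP, hQ, coeff_add, card_pow_add]
  | term a m =>
    rw [tau_mul_C_mul_tau_pow, coeff_C_mul_tau_pow, coeff_C_mul_tau_pow]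
    by_cases h : m = n <;> simp [h, Fintype.card_ne_zero]

/-- Written in the shape in which `powerStep` computes it: one scaling, then two additions of scalar
multiples. The factor `C 1` is the scalar that the program reads from memory. -/
theorem phiX_mul (j w : L) (P : OrePoly F L) :
    phiX j w * P =
      C F L w * P + C F L 1 * (tau F L * P) + C F L j⁻¹ * (tau F L * (tau F L * P)) := by
  rw [phiX, map_one, one_mul, add_mul, add_mul, pow_two]
  simp only [mul_assoc]
  abel

/-- The coefficients of `P` of index at least `n` vanish. -/
def LengthLe (P : OrePoly F L) (n : ℕ) : Prop := ∀ i, n ≤ i → P.coeff i = 0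

namespace LengthLe

variable {P Q : OrePoly F L} {m n : ℕ}

theorem mono (h : P.LengthLe m) (hmn : m ≤ n) : P.LengthLe n := fun i hi => h i (hmn.trans hi)

theorem zero (n : ℕ) : (0 : OrePoly F L).LengthLe n := fun _ _ => rfl

theorem add (hP : P.LengthLe n) (hQ : Q.LengthLe n) : (P + Q).LengthLe n := fun i hi => by
  rw [coeff_add, hP i hi, hQ i hi, add_zero]

theorem sub (hP : P.LengthLe n) (hQ : Q.LengthLe n) : (P - Q).LengthLe n := fun i hi => by
  rw [coeff_sub, hP i hi, hQ i hi, sub_zero]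

theorem C_mul (hP : P.LengthLe n) (c : L) : (C F L c * P).LengthLe n := fun i hi => by
  rw [coeff_C_mul, hP i hi, mul_zero]

theorem tau_mul (hP : P.LengthLe n) : (tau F L * P).LengthLe (n + 1) := fun i hi => by
  obtain ⟨i, rfl⟩ : ∃ k, i = k + 1 := ⟨i - 1, by omega⟩
  rw [coeff_tau_mul_succ, hP i (by omega), zero_pow Fintype.card_ne_zero]

theorem one : (1 : OrePoly F L).LengthLe 1 := fun i hi => by
  rw [coeff_one, if_neg (by omega)]

theorem tau_pow (n : ℕ) : (tau F L ^ n).LengthLe (n + 1) := fun i hi => by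
  rw [coeff_tau_pow, if_neg (by omega)]

theorem sum {ι : Type*} {s : Finset ι} {f : ι → OrePoly F L}
    (h : ∀ i ∈ s, (f i).LengthLe n) : (∑ i ∈ s, f i).LengthLe n := by
  classical
  induction s using Finset.induction_on with
  | empty => exact zero n
  | insert a s ha ih =>
    rw [Finset.sum_insert ha]
    exact (h _ (Finset.mem_insert_self _ _)).add
      (ih fun i hi => h i (Finset.mem_insert_of_mem hi))

theorem phiX_pow (j w : L) (k : ℕ) : (phiX (F := F) j w ^ k).LengthLe (2 * k + 1) := by
  induction k with
  | zero => simpa using one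
  | succ k ih =>
    rw [pow_succ', phiX_mul]
    exact (((ih.C_mul _).mono (by omega)).add ((ih.tau_mul.C_mul _).mono (by omega))).add
      (ih.tau_mul.tau_mul.C_mul _)

/-- Since `φ` has `τ`-degree at most `2`, the Mumford bound on degrees makes both evaluations have
length at most `d`. This is what makes `τ ^ d - V` monic of degree `d`. -/
theorem aeval_phiX (j w : L) (u : Polynomial F) (hu : u.natDegree ≤ n) :
    (Polynomial.aeval (phiX (F := F) j w) u).LengthLe (2 * n + 1) := by
  rw [Polynomial.aeval_eq_sum_range]
  refine sum fun i hi => ?_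
  rw [Algebra.smul_def]
  refine LengthLe.mono ((phiX_pow j w i).C_mul _) ?_
  have := Finset.mem_range.1 hi
  omega

theorem tauDegree_eq (h : P.LengthLe (n + 1)) (hn : P.coeff n ≠ 0) : P.tauDegree = n := by
  refine le_antisymm (Finset.sup_le fun i hi => ?_)
    (Finset.le_sup (f := id) (SkewPolynomial.mem_support_iff.2 hn))
  by_contra hlt
  exact SkewPolynomial.mem_support_iff.1 hi (h i (by simpa using hlt))

end LengthLe

/-- A common range of summation for `u` and `v`, because a single loop up to `d` accumulates both
sums. -/
theorem aeval_eq_sum (φ : OrePoly F L) (u : Polynomial F) (d : ℕ) (hu : u.natDegree < d) :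
    Polynomial.aeval φ u =
      ∑ i ∈ Finset.range d, C F L (algebraMap F L (u.coeff i)) * φ ^ i := by
  rw [Polynomial.aeval_eq_sum_range' hu]
  exact Finset.sum_congr rfl fun i _ => Algebra.smul_def _ _

end OrePoly

/-! ## Reasoning about programs -/

namespace Prog

/-- The index variables that a program may change. -/
def idxWrites : Prog → List ℕ
  | .idxConst x _ | .idxAdd x _ _ | .idxSub x _ _ => [x]
  | .seq P Q | .ifLt _ _ P Q | .ifZero _ _ P Q => P.idxWrites ++ Q.idxWrites
  | .whileLt _ _ P => P.idxWrites
  | _ => []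

/-- The arrays that a program may change. -/
def valWrites : Prog → List ℕ
  | .zero a _ | .one a _ | .copy a _ _ _ | .arith _ a _ _ _ _ _ => [a]
  | .seq P Q | .ifLt _ _ P Q | .ifZero _ _ P Q => P.valWrites ++ Q.valWrites
  | .whileLt _ _ P => P.valWrites
  | _ => []

end Prog

namespace Store

variable {K : Type*}

@[simp] theorem idx_setIdx (s : Store K) (x n y : ℕ) :
    (s.setIdx x n).idx y = if y = x then n else s.idx y := by
  simp [setIdx, Function.update_apply]

@[simp] theorem val_setIdx (s : Store K) (x n : ℕ) : (s.setIdx x n).val = s.val := rfl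

@[simp] theorem idx_setVal (s : Store K) (a i : ℕ) (c : K) : (s.setVal a i c).idx = s.idx := rfl

@[simp] theorem val_setVal (s : Store K) (a i : ℕ) (c : K) (b : ℕ) :
    (s.setVal a i c).val b = if b = a then Function.update (s.val a) i c else s.val b := by
  simp only [setVal, Function.update_apply]

end Store

section Logic

variable {K : Type*} [Field K] {P Q R : Prog} {s s' s'' : Store K} {t t' T T' : ℕ}

/-- Frame property: what a program does not syntactically write is preserved. With its analogue for
arrays, it supplies the preservation facts of the loop rule. -/
theorem Exec.idx_eq (h : Exec P s s' t) : ∀ x ∉ P.idxWrites, s'.idx x = s.idx x := by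
  induction h with
  | seq _ _ ih ih' =>
    intro x hx
    simp only [Prog.idxWrites, List.mem_append, not_or] at hx
    rw [ih' x hx.2, ih x hx.1]
  | ifLt_true _ _ ih | ifZero_true _ _ ih =>
    intro x hx
    simp only [Prog.idxWrites, List.mem_append, not_or] at hx
    exact ih x hx.1
  | ifLt_false _ _ ih | ifZero_false _ _ ih =>
    intro x hx
    simp only [Prog.idxWrites, List.mem_append, not_or] at hx
    exact ih x hx.2
  | while_step _ _ _ ih ih' =>
    intro x hx
    rw [ih' x hx, ih x hx]
  | _ => intro x hx; first | rfl | simp_all [Prog.idxWrites]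

theorem Exec.val_eq (h : Exec P s s' t) : ∀ a ∉ P.valWrites, s'.val a = s.val a := by
  induction h with
  | seq _ _ ih ih' =>
    intro x hx
    simp only [Prog.valWrites, List.mem_append, not_or] at hx
    rw [ih' x hx.2, ih x hx.1]
  | ifLt_true _ _ ih | ifZero_true _ _ ih =>
    intro x hx
    simp only [Prog.valWrites, List.mem_append, not_or] at hx
    exact ih x hx.1
  | ifLt_false _ _ ih | ifZero_false _ _ ih =>
    intro x hx
    simp only [Prog.valWrites, List.mem_append, not_or] at hx
    exact ih x hx.2
  | while_step _ _ _ ih ih' =>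
    intro x hx
    rw [ih' x hx, ih x hx]
  | _ => intro x hx; first | rfl | simp_all [Prog.valWrites]

/-- Started in `s`, the program `P` halts within `T` steps, in a memory satisfying `Q`. -/
def HaltsWith (P : Prog) (s : Store K) (T : ℕ) (Q : Store K → Prop) : Prop :=
  ∃ s' t, Exec P s s' t ∧ t ≤ T ∧ Q s'

/-! ### Hoare-style rules with a step budget -/

namespace HaltsWith

variable {Q Q' : Store K → Prop}

theorem mono (h : HaltsWith P s T Q) (hT : T ≤ T') (hQ : ∀ s', Q s' → Q' s') :
    HaltsWith P s T' Q' :=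
  let ⟨s', t, he, ht, hs⟩ := h
  ⟨s', t, he, ht.trans hT, hQ s' hs⟩

/-- The postcondition of the first program is the halting statement for the second, so a straight
sequence is verified by running it symbolically from left to right. -/
theorem seq (h : HaltsWith P s T fun s' => HaltsWith R s' T' Q) :
    HaltsWith (.seq P R) s (T + T') Q :=
  let ⟨_, _, he, ht, s'', _, he', ht', hs⟩ := h
  ⟨s'', _, he.seq he', add_le_add ht ht', hs⟩

theorem idxConst {x n : ℕ} (h : Q (s.setIdx x n)) : HaltsWith (.idxConst x n) s 1 Q :=
  ⟨_, _, .idxConst s x n, le_rfl, h⟩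

theorem idxAdd {x y z : ℕ} (h : Q (s.setIdx x (s.idx y + s.idx z))) :
    HaltsWith (.idxAdd x y z) s 1 Q :=
  ⟨_, _, .idxAdd s x y z, le_rfl, h⟩

theorem idxSub {x y z : ℕ} (h : Q (s.setIdx x (s.idx y - s.idx z))) :
    HaltsWith (.idxSub x y z) s 1 Q :=
  ⟨_, _, .idxSub s x y z, le_rfl, h⟩

theorem zero {a x : ℕ} (h : Q (s.setVal a (s.idx x) 0)) : HaltsWith (.zero a x) s 1 Q :=
  ⟨_, _, .zero s a x, le_rfl, h⟩

theorem one {a x : ℕ} (h : Q (s.setVal a (s.idx x) 1)) : HaltsWith (.one a x) s 1 Q :=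
  ⟨_, _, .one s a x, le_rfl, h⟩

theorem copy {a x b y : ℕ} (h : Q (s.setVal a (s.idx x) (s.val b (s.idx y)))) :
    HaltsWith (.copy a x b y) s 1 Q :=
  ⟨_, _, .copy s a x b y, le_rfl, h⟩

theorem arith {op : FieldOp} {a x b y c z : ℕ}
    (h : Q (s.setVal a (s.idx x) (op.eval (s.val b (s.idx y)) (s.val c (s.idx z))))) :
    HaltsWith (.arith op a x b y c z) s 1 Q :=
  ⟨_, _, .arith s op a x b y c z, le_rfl, h⟩

theorem ifZero_true {a x : ℕ} (hz : s.val a (s.idx x) = 0) (h : HaltsWith P s T Q) :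
    HaltsWith (.ifZero a x P R) s (T + 1) Q :=
  let ⟨s', _, he, ht, hs⟩ := h
  ⟨s', _, .ifZero_true hz he, Nat.succ_le_succ ht, hs⟩

theorem ifZero_false {a x : ℕ} (hz : s.val a (s.idx x) ≠ 0) (h : HaltsWith R s T Q) :
    HaltsWith (.ifZero a x P R) s (T + 1) Q :=
  let ⟨s', _, he, ht, hs⟩ := h
  ⟨s', _, .ifZero_false hz he, Nat.succ_le_succ ht, hs⟩

/-- A while loop whose number of steps is bounded by a potential `Φ`. -/
theorem whileLt {x y : ℕ} (I : Store K → Prop) (Φ : Store K → ℕ)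
    (hpos : ∀ s, I s → 1 ≤ Φ s)
    (hstep : ∀ s, I s → s.idx x < s.idx y →
      ∃ T, HaltsWith P s T fun s' => I s' ∧ Φ s' + T + 1 ≤ Φ s)
    (hs : I s) (hQ : ∀ s', I s' → ¬ s'.idx x < s'.idx y → Q s') :
    HaltsWith (.whileLt x y P) s (Φ s) Q := by
  -- Each round lowers the potential by its own cost and the loop test, so the induction yields
  -- termination and the step bound at once. `hpos` pays for the final failing test.
  induction hn : Φ s using Nat.strong_induction_on generalizing s with
  | _ n ih =>
    subst hn
    by_cases hxy : s.idx x < s.idx y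
    · obtain ⟨T, s', t, he, ht, hI, hΦ⟩ := hstep s hs hxy
      obtain ⟨s'', t', he', ht', hq⟩ := ih (Φ s') (by omega) hI rfl
      exact ⟨s'', _, .while_step hxy he he', by omega, hq⟩
    · exact ⟨s, 1, .while_done hxy, hpos s hs, hQ s hs hxy⟩

end HaltsWith

/-- `for i = lo, …, hi - 1 do P`, where the index variables `2` and `3` hold `1` and `0`. -/
def forLoop (i lo hi : ℕ) (P : Prog) : Prog :=
  .seq (.idxAdd i lo 3) (.whileLt i hi (.seq P (.idxAdd i i 2)))

/-- The rule for counted loops; the invariant `I` depends on the counter and the arrays. -/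
theorem HaltsWith.forLoop {i lo hi : ℕ} {Q : Store K → Prop} (I : ℕ → (ℕ → ℕ → K) → Prop)
    (h2 : s.idx 2 = 1) (h3 : s.idx 3 = 0) (hle : s.idx lo ≤ s.idx hi)
    (hi2 : i ≠ 2) (hihi : i ≠ hi) (hPi : i ∉ P.idxWrites)
    (hP2 : 2 ∉ P.idxWrites) (hPhi : hi ∉ P.idxWrites)
    (h0 : I (s.idx lo) s.val)
    (hstep : ∀ (k : ℕ) (s' : Store K), s.idx lo ≤ k → k < s.idx hi → s'.idx i = k →
      (∀ x, x ≠ i → x ∉ P.idxWrites → s'.idx x = s.idx x) →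
      (∀ a ∉ P.valWrites, s'.val a = s.val a) → I k s'.val →
      HaltsWith P s' T fun s'' => I (k + 1) s''.val)
    (hQ : ∀ s', (∀ x, x ≠ i → x ∉ P.idxWrites → s'.idx x = s.idx x) →
      (∀ a ∉ P.valWrites, s'.val a = s.val a) → I (s.idx hi) s'.val → Q s') :
    HaltsWith (_root_.forLoop i lo hi P) s (2 + (s.idx hi - s.idx lo) * (T + 2)) Q := by
  -- The frame facts belong to the loop invariant, so that the body may rely on everything that
  -- earlier rounds left untouched. In `Φ`, each round pays `T` for the body plus two steps for the
  -- increment and the test.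
  let J : Store K → Prop := fun s' => s.idx lo ≤ s'.idx i ∧ s'.idx i ≤ s.idx hi ∧
    (∀ x, x ≠ i → x ∉ P.idxWrites → s'.idx x = s.idx x) ∧
    (∀ a ∉ P.valWrites, s'.val a = s.val a) ∧ I (s'.idx i) s'.val
  let Φ : Store K → ℕ := fun s' => 1 + (s.idx hi - s'.idx i) * (T + 2)
  have hstart : (s.setIdx i (s.idx lo + s.idx 3)).idx i = s.idx lo := by simp [h3]
  have hloop : HaltsWith (.whileLt i hi (.seq P (.idxAdd i i 2)))
      (s.setIdx i (s.idx lo + s.idx 3)) (Φ (s.setIdx i (s.idx lo + s.idx 3))) Q := by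
    refine HaltsWith.whileLt J Φ (fun _ _ => Nat.le_add_right _ _) ?_ ?_ ?_
    · rintro s' ⟨hlo, hhi, hidx, hval, hI⟩ hlt
      rw [hidx hi hihi.symm hPhi] at hlt
      obtain ⟨s'', t, he, ht, hI'⟩ := hstep _ s' hlo hlt rfl hidx hval hI
      have e2 : s''.idx 2 = 1 := by rw [he.idx_eq 2 hP2, hidx 2 hi2.symm hP2, h2]
      have ei : s''.idx i = s'.idx i := he.idx_eq i hPi
      have key : (s''.setIdx i (s''.idx i + s''.idx 2)).idx i = s'.idx i + 1 := by simp [ei, e2]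
      refine ⟨T + 1, HaltsWith.seq ⟨s'', t, he, ht, HaltsWith.idxAdd ⟨⟨?_, ?_, ?_, ?_, ?_⟩, ?_⟩⟩⟩
      · omega
      · omega
      · intro x hx hxP
        rw [Store.idx_setIdx, if_neg hx, he.idx_eq x hxP, hidx x hx hxP]
      · intro a ha
        rw [Store.val_setIdx, he.val_eq a ha, hval a ha]
      · rw [key]
        exact hI'
      · simp only [Φ, key]
        obtain ⟨r, hr⟩ : ∃ r, s.idx hi = s'.idx i + 1 + r := ⟨_, (Nat.add_sub_of_le hlt).symm⟩
        rw [hr, Nat.add_sub_cancel_left, show s'.idx i + 1 + r - s'.idx i = r + 1 by omega, add_mul]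
        omega
    · refine ⟨hstart.ge, hstart.le.trans hle, ?_, fun _ _ => rfl, ?_⟩
      · intro x hx _
        rw [Store.idx_setIdx, if_neg hx]
      · rw [hstart]
        exact h0
    · rintro s' ⟨hlo, hhi, hidx, hval, hI⟩ hlt
      rw [hidx hi hihi.symm hPhi] at hlt
      refine hQ s' hidx hval ?_
      rwa [le_antisymm (not_lt.1 hlt) hhi]
  refine HaltsWith.mono (HaltsWith.seq (HaltsWith.idxAdd hloop)) ?_ fun _ h => h
  simp only [Φ, hstart]
  omega

end Logic

/-! ## Elementary operations on Ore polynomials stored in arrays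

Throughout, the index variables `0`, `2`, `3`, `4` hold `q`, `1`, `0` and a bound `N` for the
lengths; the cell `0` of the array `9` holds a scalar operand, the array `7` and the index
variables `5`, `6`, `7` are scratch. -/

section Primitives

/-- The constants that the index variables hold during a run. -/
structure Store.HasConsts {L : Type*} (s : Store L) (q N : ℕ) : Prop where
  idx_zero : s.idx 0 = q
  idx_two : s.idx 2 = 1
  idx_three : s.idx 3 = 0
  idx_four : s.idx 4 = N

theorem Store.HasConsts.congr {L : Type*} {s s' : Store L} {q N : ℕ} (h : s.HasConsts q N)
    (h0 : s'.idx 0 = s.idx 0) (h2 : s'.idx 2 = s.idx 2) (h3 : s'.idx 3 = s.idx 3)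
    (h4 : s'.idx 4 = s.idx 4) : s'.HasConsts q N :=
  ⟨h0.trans h.1, h2.trans h.2, h3.trans h.3, h4.trans h.4⟩

variable {F L : Type*} [Field F] [Fintype F] [Field L] [Algebra F L]
  {s : Store L} {N q : ℕ} {Q : Store L → Prop}

open OrePoly

/-- `r[0] := a[x] ^ q`, where `r` is the array `7`. -/
def frobCell (a x : ℕ) : Prog :=
  .seq (.one 7 3) (forLoop 5 3 0 (.arith .mul 7 3 7 3 a x))

theorem halts_frobCell {a x : ℕ} (hs : s.HasConsts q N) (ha : a ≠ 7) (hx : x ≠ 5)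
    (hQ : ∀ s' : Store L, s'.val 7 0 = s.val a (s.idx x) ^ q →
      (∀ y, y ≠ 5 → s'.idx y = s.idx y) → (∀ b, b ≠ 7 → s'.val b = s.val b) → Q s') :
    HaltsWith (frobCell a x) s (3 * q + 3) Q := by
  refine HaltsWith.mono (HaltsWith.seq (HaltsWith.one (HaltsWith.forLoop (T := 1)
    (fun k v => v 7 0 = s.val a (s.idx x) ^ k) ?_ ?_ ?_ ?_ ?_ ?_ ?_ ?_ ?_ ?_
      fun s' h1 h2 h3 => hQ s' ?_ ?_ ?_))) ?_ fun _ h => h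
  any_goals simp [Prog.idxWrites, hs.2, hs.3, hs.1]
  · intro k s' hk hi hidx hval hI
    refine HaltsWith.arith ?_
    have e3 : s'.idx 3 = 0 := by rw [hidx 3 (by simp), hs.3]
    have ex : s'.idx x = s.idx x := hidx x hx
    have ea : s'.val a = s.val a := by
      rw [hval a (by simpa [Prog.valWrites] using ha), if_neg ha]
    simp [FieldOp.eval, e3, ex, ea, hI, pow_succ]
  · simpa [hs.1] using h3
  · intro y hy
    simpa using h1 y hy (by simp [Prog.idxWrites])
  · intro b hb
    simpa [hb] using h2 b (by simpa [Prog.valWrites] using hb)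
  · omega

/-- `a := a + c * b`, where `c` is the scalar operand. -/
def axpyLoop (a b : ℕ) : Prog :=
  forLoop 7 3 4 (.seq (.arith .mul 7 3 9 3 b 7) (.arith .add a 7 a 7 7 3))

theorem halts_axpyLoop {a b : ℕ} {A B : OrePoly F L} (hs : s.HasConsts q N)
    (ha : s.val a = A.coeff) (hb : s.val b = B.coeff) (hB : B.LengthLe N)
    (ha7 : a ≠ 7) (hb7 : b ≠ 7) (ha9 : a ≠ 9) (hab : a ≠ b)
    (hQ : ∀ s' : Store L, s'.val a = (A + C F L (s.val 9 0) * B).coeff →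
      (∀ y, y ≠ 7 → s'.idx y = s.idx y) → (∀ b, b ≠ 7 → b ≠ a → s'.val b = s.val b) → Q s') :
    HaltsWith (axpyLoop a b) s (4 * N + 2) Q := by
  refine HaltsWith.mono (HaltsWith.forLoop (T := 2)
    -- Cells below the counter are updated, the others are original. At the end the bound `hB` shows
    -- that cells from `N` on needed no update.
    (fun k v => v a = fun i => if i < k then (A + C F L (s.val 9 0) * B).coeff i else A.coeff i)
    hs.2 hs.3 ?_ ?_ ?_ ?_ ?_ ?_ ?_ ?_ fun s' h1 h2 h3 => hQ s' ?_ ?_ ?_) ?_ fun _ h => h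
  any_goals simp [Prog.idxWrites, hs.3, hs.4]
  · exact ha
  · intro k s' hk hi hidx hval hI
    have e3 : s'.idx 3 = 0 := by rw [hidx 3 (by simp), hs.3]
    have e9 : s'.val 9 = s.val 9 := hval 9 (by simpa [Prog.valWrites] using ha9.symm)
    have eb : s'.val b = s.val b := hval b (by simp [Prog.valWrites, hb7, hab.symm])
    refine HaltsWith.seq (T := 1) (T' := 1) (HaltsWith.arith (HaltsWith.arith ?_))
    funext i
    rcases lt_trichotomy i k with h | h | h
    · simp [ha7, hI, h, h.ne, hi, h.le]
    · subst h
      simp [FieldOp.eval, ha7, hI, hi, e3, e9, eb, hb]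
    · simp [ha7, hI, h.ne', hi, h.not_gt, h.not_ge]
  · rw [hs.4] at h3
    rw [h3]
    funext i
    split
    · rfl
    · rename_i h
      simp [hB i (not_lt.1 h)]
  · intro y hy
    exact h1 y hy (by simp [Prog.idxWrites])
  · intro b hb hb'
    exact h2 b (by simp [Prog.valWrites, hb, hb'])
  · omega

/-- `a := c * b`, where `c` is the scalar operand. -/
def scaleLoop (a b : ℕ) : Prog :=
  forLoop 7 3 4 (.arith .mul a 7 9 3 b 7)

/-- The arrays may coincide: a cell is read just before it is overwritten. The length bound on the
old contents `A` is needed because cells from `N` on are never cleared. -/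
theorem halts_scaleLoop {a b : ℕ} {A B : OrePoly F L} (hs : s.HasConsts q N)
    (ha : s.val a = A.coeff) (hb : s.val b = B.coeff) (hA : A.LengthLe N) (hB : B.LengthLe N)
    (ha9 : a ≠ 9)
    (hQ : ∀ s' : Store L, s'.val a = (C F L (s.val 9 0) * B).coeff →
      (∀ y, y ≠ 7 → s'.idx y = s.idx y) → (∀ b, b ≠ a → s'.val b = s.val b) → Q s') :
    HaltsWith (scaleLoop a b) s (3 * N + 2) Q := by
  refine HaltsWith.mono (HaltsWith.forLoop (T := 1)
    (fun k v => (∀ i, k ≤ i → v b i = B.coeff i) ∧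
      v a = fun i => if i < k then (C F L (s.val 9 0) * B).coeff i else A.coeff i)
    hs.2 hs.3 ?_ ?_ ?_ ?_ ?_ ?_ ?_ ?_ fun s' h1 h2 h3 => hQ s' ?_ ?_ ?_) ?_ fun _ h => h
  any_goals simp [Prog.idxWrites, hs.3, hs.4]
  · exact ⟨fun i => by rw [hb], ha⟩
  · intro k s' hk hi hidx hval hI hI'
    have e3 : s'.idx 3 = 0 := by rw [hidx 3 (by simp), hs.3]
    have e9 : s'.val 9 = s.val 9 := hval 9 (by simpa [Prog.valWrites] using ha9.symm)
    refine HaltsWith.arith ⟨fun i hik => ?_, ?_⟩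
    · by_cases hab : b = a
      · subst hab
        simp [hi, show i ≠ k by omega, hI i (by omega)]
      · simp [hab, hI i (by omega)]
    funext i
    rcases lt_trichotomy i k with h | h | h
    · simp [hI', h, h.ne, hi, h.le]
    · subst h
      simp [FieldOp.eval, hI, hi, e3, e9]
    · simp [hI', h.ne', hi, h.not_gt, h.not_ge]
  · rw [hs.4] at h3
    rw [h3.2]
    funext i
    split
    · rfl
    · rename_i h
      simp [hB i (not_lt.1 h), hA i (not_lt.1 h)]
  · intro y hy
    exact h1 y hy (by simp [Prog.idxWrites])
  · intro b hb
    exact h2 b (by simp [Prog.valWrites, hb])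
  · omega

/-- `b := τ * a`. -/
def tauMul (b a : ℕ) : Prog :=
  .seq (.zero b 3)
    (forLoop 7 3 4 (.seq (frobCell a 7) (.seq (.idxAdd 6 7 2) (.copy b 6 7 3))))

/-- Cell `k + 1` receives the `q`-th power of cell `k`, so cells up to `N` are written; hence old
contents of length `N + 1` leave no residue. -/
theorem halts_tauMul_aux {a b : ℕ} {A B : OrePoly F L} (hs : s.HasConsts (Fintype.card F) N)
    (ha : s.val a = A.coeff) (hb : s.val b = B.coeff) (hA : A.LengthLe N)
    (hB : B.LengthLe (N + 1)) (ha7 : a ≠ 7) (hb7 : b ≠ 7) (hab : a ≠ b)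
    (hQ : ∀ s' : Store L, s'.val b = (tau F L * A).coeff →
      (∀ y, y ≠ 5 → y ≠ 6 → y ≠ 7 → s'.idx y = s.idx y) →
      (∀ c, c ≠ 7 → c ≠ b → s'.val c = s.val c) → Q s') :
    HaltsWith (tauMul b a) s (N * (3 * Fintype.card F + 7) + 3) Q := by
  refine HaltsWith.mono (HaltsWith.seq (HaltsWith.zero (HaltsWith.forLoop
    (T := 3 * Fintype.card F + 5)
    (fun k v => v b = fun i => if i < k + 1 then (tau F L * A).coeff i else B.coeff i)
    ?_ ?_ ?_ ?_ ?_ ?_ ?_ ?_ ?_ ?_ fun s' h1 h2 h3 => hQ s' ?_ ?_ ?_))) ?_ fun _ h => h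
  any_goals simp [Prog.idxWrites, hs.2, hs.3, hs.4, frobCell, _root_.forLoop]
  · funext i
    rcases Nat.eq_zero_or_pos i with rfl | h
    · simp
    · simp [h.ne', hb]
  · intro k s' hk hi hidx hval hI
    have hidx' : ∀ x, x ≠ 5 → x ≠ 6 → x ≠ 7 → s'.idx x = s.idx x := fun x h5 h6 h7 => by
      simpa using hidx x h7 h5 h6
    have ea : s'.val a = A.coeff := by
      rw [hval a (by simp [Prog.valWrites, ha7, hab]), ← ha]
      simp [hab]
    refine HaltsWith.seq (T := 3 * Fintype.card F + 3) (T' := 2)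
      (halts_frobCell (hs.congr ?_ ?_ ?_ ?_) ha7 (by simp) fun s'' g1 g2 g3 => ?_)
    any_goals exact hidx' _ (by simp) (by simp) (by simp)
    refine HaltsWith.seq (T := 1) (T' := 1) (HaltsWith.idxAdd (HaltsWith.copy ?_))
    have e7 : s''.idx 7 = k := by rw [g2 7 (by simp), hi]
    have e2 : s''.idx 2 = 1 := by rw [g2 2 (by simp), hidx' _ (by simp) (by simp) (by simp), hs.2]
    have e3 : s''.idx 3 = 0 := by rw [g2 3 (by simp), hidx' _ (by simp) (by simp) (by simp), hs.3]
    funext i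
    rcases lt_trichotomy i (k + 1) with h | h | h
    · simp [e7, e2, h.ne, g3 b hb7, hI, Nat.lt_succ_iff.1 h, h.le]
    · subst h
      simp [e7, e2, e3, g1, hi, ea]
    · simp [e7, e2, h.ne', g3 b hb7, hI, h.not_ge,
        show ¬ i ≤ k by omega]
  · simp only [Store.idx_setVal, hs.4] at h3
    rw [h3]
    funext i
    split
    · rfl
    · rename_i h
      rw [hB i (by omega), hA.tau_mul i (by omega)]
  · intro y h5 h6 h7
    simpa using h1 y h7 (by simp [Prog.idxWrites, frobCell, _root_.forLoop, h5, h6])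
  · intro c hc hc'
    simpa [hc'] using h2 c (by simp [Prog.valWrites, frobCell, _root_.forLoop, hc, hc'])
  · rw [show 3 * Fintype.card F + 5 + 2 = 3 * Fintype.card F + 7 by omega]
    omega

/-- A bound for the number of steps of an operation on arrays of length `N`. -/
def arrayCost (q N : ℕ) : ℕ := N * (3 * q + 7) + 3

theorem mul_add_three_le_arrayCost (q N : ℕ) : 7 * N + 3 ≤ arrayCost q N := by
  have h : N * 7 ≤ N * (3 * q + 7) := Nat.mul_le_mul_left N (by omega)
  unfold arrayCost
  omega

/-- `a := a + e[x] * b`. -/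
def axpy (a b e x : ℕ) : Prog := .seq (.copy 9 3 e x) (axpyLoop a b)

/-- The scalar is copied to the operand cell before the loop, so it may be an entry of the array
that is being changed, as happens in `reduceTerm`. -/
theorem halts_axpy {a b e x : ℕ} {A B : OrePoly F L} (hs : s.HasConsts q N)
    (ha : s.val a = A.coeff) (hb : s.val b = B.coeff) (hB : B.LengthLe N)
    (ha7 : a ≠ 7 := by decide) (hb7 : b ≠ 7 := by decide) (ha9 : a ≠ 9 := by decide)
    (hb9 : b ≠ 9 := by decide) (hab : a ≠ b := by decide)
    (hQ : ∀ s' : Store L, s'.HasConsts q N →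
      s'.val a = (A + C F L (s.val e (s.idx x)) * B).coeff →
      (∀ y, y ≠ 5 → y ≠ 6 → y ≠ 7 → s'.idx y = s.idx y) →
      (∀ b, b ≠ 7 → b ≠ 9 → b ≠ a → s'.val b = s.val b) → Q s') :
    HaltsWith (axpy a b e x) s (arrayCost q N) Q := by
  refine HaltsWith.mono (HaltsWith.seq (HaltsWith.copy (halts_axpyLoop (A := A) (B := B)
    (hs.congr rfl rfl rfl rfl) ?_ ?_ hB ha7 hb7 ha9 hab fun s' h1 h2 h3 => hQ s' ?_ ?_ ?_ ?_)))
    (T := 1 + (4 * N + 2)) ?_ fun _ h => h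
  · simpa [ha9] using ha
  · simpa [hb9] using hb
  · exact hs.congr (h2 _ (by decide)) (h2 _ (by decide)) (h2 _ (by decide)) (h2 _ (by decide))
  · simpa [hs.3] using h1
  · exact fun y _ _ hy => h2 y hy
  · exact fun c h7 h9 hc => by simpa [h9] using h3 c h7 hc
  · have := mul_add_three_le_arrayCost q N
    omega

/-- `a := e[x] * b`. -/
def scale (a b e x : ℕ) : Prog := .seq (.copy 9 3 e x) (scaleLoop a b)

theorem halts_scale {a b e x : ℕ} {A B : OrePoly F L} (hs : s.HasConsts q N)
    (ha : s.val a = A.coeff) (hb : s.val b = B.coeff) (hA : A.LengthLe N) (hB : B.LengthLe N)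
    (ha9 : a ≠ 9 := by decide) (hb9 : b ≠ 9 := by decide)
    (hQ : ∀ s' : Store L, s'.HasConsts q N →
      s'.val a = (C F L (s.val e (s.idx x)) * B).coeff →
      (∀ y, y ≠ 5 → y ≠ 6 → y ≠ 7 → s'.idx y = s.idx y) →
      (∀ b, b ≠ 7 → b ≠ 9 → b ≠ a → s'.val b = s.val b) → Q s') :
    HaltsWith (scale a b e x) s (arrayCost q N) Q := by
  refine HaltsWith.mono (HaltsWith.seq (HaltsWith.copy (halts_scaleLoop (A := A) (B := B)
    (hs.congr rfl rfl rfl rfl) ?_ ?_ hA hB ha9 fun s' h1 h2 h3 => hQ s' ?_ ?_ ?_ ?_)))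
    (T := 1 + (3 * N + 2)) ?_ fun _ h => h
  · simpa [ha9] using ha
  · simpa [hb9] using hb
  · exact hs.congr (h2 _ (by decide)) (h2 _ (by decide)) (h2 _ (by decide)) (h2 _ (by decide))
  · simpa [hs.3] using h1
  · exact fun y _ _ hy => h2 y hy
  · exact fun c h7 h9 hc => by simpa [h9] using h3 c hc
  · have := mul_add_three_le_arrayCost q N
    omega

theorem halts_tauMul {a b : ℕ} {A B : OrePoly F L} (hs : s.HasConsts (Fintype.card F) N)
    (ha : s.val a = A.coeff) (hb : s.val b = B.coeff) (hA : A.LengthLe N)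
    (hB : B.LengthLe (N + 1)) (ha7 : a ≠ 7 := by decide) (hb7 : b ≠ 7 := by decide)
    (hab : a ≠ b := by decide)
    (hQ : ∀ s' : Store L, s'.HasConsts (Fintype.card F) N → s'.val b = (tau F L * A).coeff →
      (∀ y, y ≠ 5 → y ≠ 6 → y ≠ 7 → s'.idx y = s.idx y) →
      (∀ c, c ≠ 7 → c ≠ 9 → c ≠ b → s'.val c = s.val c) → Q s') :
    HaltsWith (tauMul b a) s (arrayCost (Fintype.card F) N) Q :=
  halts_tauMul_aux hs ha hb hA hB ha7 hb7 hab fun s' h1 h2 h3 => hQ s'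
    (hs.congr (h2 _ (by decide) (by decide) (by decide)) (h2 _ (by decide) (by decide) (by decide))
      (h2 _ (by decide) (by decide) (by decide)) (h2 _ (by decide) (by decide) (by decide)))
    h1 h2 fun c h7 _ hc => h3 c h7 hc

end Primitives

/-! ## Right Euclidean division -/

namespace OrePoly

variable {F L : Type*} [Field F] [Fintype F] [Field L] [Algebra F L]

theorem span_C_mul {c : L} (hc : c ≠ 0) (B : OrePoly F L) :
    Ideal.span {C F L c * B} = Ideal.span {B} := by
  refine le_antisymm ?_ ?_ <;> rw [Ideal.span_singleton_le_iff_mem]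
  · exact Ideal.mul_mem_left _ _ (Ideal.mem_span_singleton_self _)
  · have h := Ideal.mul_mem_left (Ideal.span {C F L c * B}) (C F L c⁻¹)
      (Ideal.mem_span_singleton_self (C F L c * B))
    rwa [← mul_assoc, ← map_mul, inv_mul_cancel₀ hc, map_one, one_mul] at h

/-- Invariance of the left ideal under a Euclidean round: rescale `B`, replace `A` by something
congruent to it modulo `B'`, and exchange the two. -/
theorem span_pair_eq {A A' B B' : OrePoly F L} (hB : Ideal.span {B'} = Ideal.span {B})
    (hA : A' - A ∈ Ideal.span {B'}) : Ideal.span {B', A'} = Ideal.span {A, B} := by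
  rw [Ideal.span_insert, hB, Ideal.span_insert, sup_comm]
  rw [hB] at hA
  refine le_antisymm (sup_le ?_ le_sup_right) (sup_le ?_ le_sup_right) <;>
    rw [Ideal.span_singleton_le_iff_mem]
  · rw [← sub_add_cancel A' A]
    exact add_mem (Ideal.mem_sup_right hA)
      (Ideal.mem_sup_left (Ideal.mem_span_singleton_self _))
  · rw [← sub_sub_cancel A' A]
    exact sub_mem (Ideal.mem_sup_left (Ideal.mem_span_singleton_self _))
      (Ideal.mem_sup_right hA)

end OrePoly

/-- One step of the division of the array `14` by the monic array `15`, whose degree the index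
variable `11` holds: the term of degree `k` is replaced by its remainder, where `k` is held by
the index variable `8` and the array `17` holds the remainder of `τ ^ k`. -/
def reduceTerm : Prog :=
  .seq (axpy 14 17 14 8) <| .seq (.zero 14 8) <| .seq (tauMul 18 17) <|
    .seq (.arith .mul 19 3 16 2 18 11) <| .seq (axpy 18 15 19 3) (scale 17 18 16 3)

section

variable {F L : Type*} [Field F] [Fintype F] [Field L] [Algebra F L]

open OrePoly

/-- Since `S` has length at most `b ≤ k`, adding a multiple of it does not touch the coefficient of
`τ ^ k`; clearing that cell is then the same as subtracting the term itself. The arrays `17` and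
`18` both end with the remainder to be used for `τ ^ (k + 1)`. -/
theorem halts_reduceTerm {s : Store L} {N k b : ℕ} {A S U B : OrePoly F L} {Q : Store L → Prop}
    (hs : s.HasConsts (Fintype.card F) N) (h8 : s.idx 8 = k) (h11 : s.idx 11 = b)
    (hA : s.val 14 = A.coeff) (hB : s.val 15 = B.coeff) (hS : s.val 17 = S.coeff)
    (hU : s.val 18 = U.coeff) (h16 : s.val 16 0 = 1) (h16' : s.val 16 1 = -1)
    (lB : B.LengthLe (b + 1)) (lS : S.LengthLe b) (lU : U.LengthLe N) (hbk : b ≤ k)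
    (hbN : b + 1 ≤ N)
    (hQ : ∀ s' : Store L,
      s'.val 14 = (A + C F L (A.coeff k) * S - C F L (A.coeff k) * tau F L ^ k).coeff →
      s'.val 17 = (tau F L * S - C F L ((tau F L * S).coeff b) * B).coeff →
      s'.val 18 = (tau F L * S - C F L ((tau F L * S).coeff b) * B).coeff →
      Q s') :
    HaltsWith reduceTerm s (4 * arrayCost (Fintype.card F) N + 2) Q := by
  set W := arrayCost (Fintype.card F) N
  refine HaltsWith.mono (T := W + (1 + (W + (1 + (W + W))))) ?_ (by omega) fun _ h => h
  refine HaltsWith.seq (halts_axpy hs hA hS (lS.mono (by omega)) (hQ := fun s1 c1 r1 i1 v1 => ?_))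
  refine HaltsWith.seq (HaltsWith.zero ?_)
  refine HaltsWith.seq (halts_tauMul (A := S) (B := U) (c1.congr rfl rfl rfl rfl)
    (by simp [v1, hS]) (by simp [v1, hU]) (lS.mono (by omega)) (lU.mono (by omega))
    (hQ := fun s2 c2 r2 i2 v2 => ?_))
  refine HaltsWith.seq (HaltsWith.arith ?_)
  refine HaltsWith.seq (halts_axpy (A := tau F L * S) (B := B) (c2.congr rfl rfl rfl rfl)
    (by simp [r2]) (by simp [v1, v2, hB]) (lB.mono hbN) (hQ := fun s3 c3 r3 i3 v3 => ?_))
  have r3' : s3.val 18 = (tau F L * S - C F L ((tau F L * S).coeff b) * B).coeff := by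
    rw [r3]
    simp [FieldOp.eval, c2.2, c2.3, v2, v1, h16', r2, i2, i1, h11]
    rw [sub_eq_add_neg]
  refine halts_scale (A := S) (B := tau F L * S - C F L ((tau F L * S).coeff b) * B) c3 ?_ r3'
    (lS.mono (by omega)) ((lS.tau_mul.mono (by omega)).sub ((lB.C_mul _).mono hbN))
    (hQ := fun s4 c4 r4 i4 v4 => hQ s4 ?_ ?_ ?_)
  · simp [v3, v2, v1, hS]
  · funext i
    simp [v4, v3, v2, r1, h8, i1, hA]
    by_cases h : i = k
    · subst h
      simp [coeff_tau_pow, lS i hbk]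
    · simp [h, coeff_tau_pow, Ne.symm h]
  · rw [r4]
    simp [c3.3, v3, v2, v1, h16]
  · simp [v4, r3']

/-- Division of the array `14`, of length at most the index variable `9`, by the monic array `15`,
whose degree the index variable `11` holds. -/
def reduce : Prog :=
  .seq (scale 17 15 16 2) <| .seq (.zero 17 11) (forLoop 8 11 9 reduceTerm)

/-- The loop maintains that the array `17` is congruent to `τ ^ k` and the array `14` to `A`, modulo
the left ideal of `B`. Replacements have degree below `b`, so going through `k` upwards never
refills a cleared cell. `S` and `U` stand for leftover scratch contents, of which only the length
matters. -/
theorem halts_reduce {s : Store L} {N a b : ℕ} {A S U B : OrePoly F L} {Q : Store L → Prop}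
    (hs : s.HasConsts (Fintype.card F) N) (h9 : s.idx 9 = a) (h11 : s.idx 11 = b)
    (hA : s.val 14 = A.coeff) (hB : s.val 15 = B.coeff) (hS : s.val 17 = S.coeff)
    (hU : s.val 18 = U.coeff) (h16 : s.val 16 0 = 1) (h16' : s.val 16 1 = -1)
    (lA : A.LengthLe a) (lB : B.LengthLe (b + 1)) (hBb : B.coeff b = 1) (lS : S.LengthLe N)
    (lU : U.LengthLe N) (hba : b ≤ a) (hbN : b + 1 ≤ N)
    (hQ : ∀ (s' : Store L) (A' S' U' : OrePoly F L), s'.HasConsts (Fintype.card F) N →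
      s'.val 14 = A'.coeff → s'.val 17 = S'.coeff → s'.val 18 = U'.coeff →
      A'.LengthLe b → S'.LengthLe N → U'.LengthLe N → A' - A ∈ Ideal.span {B} →
      (∀ x, x ≠ 5 → x ≠ 6 → x ≠ 7 → x ≠ 8 → s'.idx x = s.idx x) →
      (∀ c, c ≠ 7 → c ≠ 9 → c ≠ 14 → c ≠ 17 → c ≠ 18 → c ≠ 19 → s'.val c = s.val c) → Q s') :
    HaltsWith reduce s ((a - b + 1) * (4 * arrayCost (Fintype.card F) N + 4)) Q := by
  set W := arrayCost (Fintype.card F) N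
  refine HaltsWith.mono (T := W + (1 + (2 + (a - b) * (4 * W + 2 + 2)))) ?_ ?_ fun _ h => h
  swap
  · rw [add_mul, one_mul, show 4 * W + 2 + 2 = 4 * W + 4 from rfl]
    omega
  refine HaltsWith.seq (halts_scale hs hS hB lS (lB.mono hbN)
    (hQ := fun s1 c1 r1 i1 v1 => HaltsWith.seq (HaltsWith.zero ?_)))
  have e11 : s1.idx 11 = b := by simp [i1, h11]
  have e9 : s1.idx 9 = a := by simp [i1, h9]
  have lim : ((s1.setVal 17 (s1.idx 11) 0).idx 9 - (s1.setVal 17 (s1.idx 11) 0).idx 11) = a - b := by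
    simp [e11, e9]
  rw [← lim]
  refine HaltsWith.forLoop (T := 4 * W + 2) (fun k v => ∃ A' S' U' : OrePoly F L,
    v 14 = A'.coeff ∧ v 17 = S'.coeff ∧ v 18 = U'.coeff ∧ A'.LengthLe a ∧
      (∀ i, b ≤ i → i < k → A'.coeff i = 0) ∧ S'.LengthLe b ∧ U'.LengthLe N ∧
      A' - A ∈ Ideal.span {B} ∧ S' - tau F L ^ k ∈ Ideal.span {B})
    ?_ ?_ ?_ (by decide) (by decide) (by decide) (by decide) (by decide) ?_ ?_ ?_
  · simp [c1.2]
  · simp [c1.3]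
  · simpa [e9, e11] using hba
  -- The first remainder: as `B` is monic of degree `b`, `τ ^ b - B` has degree below `b`. In memory
  -- it is `-B` with cell `b` cleared.
  · refine ⟨A, tau F L ^ b - B, U, ?_, ?_, ?_, lA, ?_, ?_, lU, ?_, ?_⟩
    · simp [v1, hA]
    · funext i
      by_cases h : i = b
      · subst h
        simp [e11, coeff_tau_pow, hBb]
      · simp [e11, h, r1, hs.2, h16', coeff_tau_pow, Ne.symm h]
    · simp [v1, hU]
    · intro i h1 h2
      simp [e11] at h2
      omega
    · intro i hi
      rcases hi.eq_or_lt with rfl | hi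
      · simp [coeff_tau_pow, hBb]
      · simp [coeff_tau_pow, hi.ne, lB i hi]
    · simp
    · simp only [Store.idx_setVal, e11]
      rw [sub_sub_cancel_left]
      exact neg_mem (Ideal.mem_span_singleton_self _)
  · rintro k s' hk hka h8 hidx hval ⟨A', S', U', g14, g17, g18, lA', zA', lS', lU', mA, mS⟩
    simp only [Store.idx_setVal, e11, e9] at hk hka
    have hval' : ∀ c, c ≠ 7 → c ≠ 9 → c ≠ 14 → c ≠ 17 → c ≠ 18 → c ≠ 19 →
        s'.val c = s.val c := by
      intro c h1 h2 h3 h4 h5 h6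
      rw [hval c, Store.val_setVal, if_neg h4, v1 c h1 h2 h4]
      simp [reduceTerm, axpy, axpyLoop, scale, scaleLoop, tauMul, frobCell, forLoop,
        Prog.valWrites, h1, h2, h3, h4, h5, h6]
    have hidx' : ∀ x, x ≠ 5 → x ≠ 6 → x ≠ 7 → x ≠ 8 → s'.idx x = s.idx x := by
      intro x h5 h6 h7 h8
      rw [hidx x h8, Store.idx_setVal, i1 x h5 h6 h7]
      simp [reduceTerm, axpy, axpyLoop, scale, scaleLoop, tauMul, frobCell, forLoop,
        Prog.idxWrites, h5, h6, h7]
    refine halts_reduceTerm (A := A') (S := S') (U := U') (B := B) (b := b)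
      (hs.congr ?_ ?_ ?_ ?_) h8 ?_ g14 ?_ g17 g18 ?_ ?_ lB lS' lU' hk hbN
      fun s'' q14 q17 q18 => ⟨_, _, _, q14, q17, q18, ?_, ?_, ?_, ?_, ?_, ?_⟩
    any_goals exact hidx' _ (by decide) (by decide) (by decide) (by decide)
    · rw [hidx' _ (by decide) (by decide) (by decide) (by decide), h11]
    · rw [hval' _ (by decide) (by decide) (by decide) (by decide) (by decide) (by decide), hB]
    · rw [hval' _ (by decide) (by decide) (by decide) (by decide) (by decide) (by decide), h16]
    · rw [hval' _ (by decide) (by decide) (by decide) (by decide) (by decide) (by decide), h16']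
    · exact (lA'.add ((lS'.C_mul _).mono hba)).sub (((LengthLe.tau_pow k).C_mul _).mono hka)
    · intro i hi hik
      rcases (Nat.lt_succ_iff.1 hik).eq_or_lt with rfl | hlt
      · simp [coeff_tau_pow, lS' i hi]
      · simp [coeff_tau_pow, lS' i hi, hlt.ne', zA' i hi hlt]
    · intro i hi
      rcases hi.eq_or_lt with rfl | hi
      · simp [hBb]
      · simp [lB i hi, lS'.tau_mul i hi]
    · exact (lS'.tau_mul.mono hbN).sub ((lB.C_mul _).mono hbN)
    -- The change is a left multiple of `S' - τ ^ k`, which lies in the left ideal of `B`.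
    · have : A' + C F L (A'.coeff k) * S' - C F L (A'.coeff k) * tau F L ^ k - A =
        (A' - A) + C F L (A'.coeff k) * (S' - tau F L ^ k) := by
        rw [mul_sub]
        abel
      rw [this]
      exact add_mem mA (Ideal.mul_mem_left _ _ mS)
    · have : tau F L * S' - C F L ((tau F L * S').coeff b) * B - tau F L ^ (k + 1) =
        tau F L * (S' - tau F L ^ k) - C F L ((tau F L * S').coeff b) * B := by
        rw [mul_sub, pow_succ']
        abel
      rw [this]
      exact sub_mem (Ideal.mul_mem_left _ _ mS)
        (Ideal.mul_mem_left _ _ (Ideal.mem_span_singleton_self _))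
  · rintro s' hidx hval ⟨A', S', U', g14, g17, g18, lA', zA', lS', lU', mA, mS⟩
    have hidx' : ∀ x, x ≠ 5 → x ≠ 6 → x ≠ 7 → x ≠ 8 → s'.idx x = s.idx x := by
      intro x h5 h6 h7 h8
      rw [hidx x h8, Store.idx_setVal, i1 x h5 h6 h7]
      simp [reduceTerm, axpy, axpyLoop, scale, scaleLoop, tauMul, frobCell, forLoop,
        Prog.idxWrites, h5, h6, h7]
    refine hQ s' A' S' U' (hs.congr ?_ ?_ ?_ ?_) g14 g17 g18 ?_ (lS'.mono (by omega)) lU' mA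
      hidx' ?_
    any_goals exact hidx' _ (by decide) (by decide) (by decide) (by decide)
    · intro i hi
      simp only [Store.idx_setVal, e9] at zA'
      rcases lt_or_ge i a with h | h
      · exact zA' i hi h
      · exact lA' i h
    · intro c h1 h2 h3 h4 h5 h6
      rw [hval c, Store.val_setVal, if_neg h4, v1 c h1 h2 h4]
      simp [reduceTerm, axpy, axpyLoop, scale, scaleLoop, tauMul, frobCell, forLoop,
        Prog.valWrites, h1, h2, h3, h4, h5, h6]

end

/-! ## The right Euclidean algorithm -/

/-- The array `15`, with leading coefficient at the position held by the index variable `11`, is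
made monic; the array `14` is reduced by it, and the two arrays are exchanged. -/
def euclidStep : Prog :=
  .seq (.arith .div 19 3 16 3 15 11) <| .seq (scale 15 15 19 3) <| .seq reduce <|
    .seq (scale 18 14 16 3) <| .seq (scale 14 15 16 3) <| .seq (scale 15 18 16 3) <|
    .seq (.idxAdd 9 10 3) (.idxAdd 10 11 3)

/-- The Euclidean algorithm on the arrays `14` and `15`, whose lengths are held by the index
variables `9` and `10`. -/
def euclid : Prog :=
  .whileLt 3 10 (.seq (.idxSub 11 10 2) (.ifZero 15 11 (.idxAdd 10 11 3) euclidStep))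

section

variable {F L : Type*} [Field F] [Fintype F] [Field L] [Algebra F L]

open OrePoly

/-- The memory during the Euclidean algorithm: the array `14` holds a monic polynomial `A` and
the array `15` a polynomial `B` such that `A`, `B` generate the left ideal `I`. -/
structure EuclidState (I : Ideal (OrePoly F L)) (N : ℕ) (A B S U : OrePoly F L)
    (s : Store L) : Prop where
  consts : s.HasConsts (Fintype.card F) N
  one : s.val 16 0 = 1
  neg_one : s.val 16 1 = -1
  val_A : s.val 14 = A.coeff
  val_B : s.val 15 = B.coeff
  val_S : s.val 17 = S.coeff
  val_U : s.val 18 = U.coeff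
  one_le : 1 ≤ s.idx 9
  le : s.idx 10 ≤ s.idx 9
  le_N : s.idx 9 ≤ N
  length_A : A.LengthLe (s.idx 9)
  monic_A : A.coeff (s.idx 9 - 1) = 1
  length_B : B.LengthLe (s.idx 10)
  length_S : S.LengthLe N
  length_U : U.LengthLe N
  span_eq : Ideal.span {A, B} = I

/-- The new pair is the normalized divisor and the remainder of `A`. The divisor's length becomes
the larger length, and the remainder has length at most one less. The exchange goes through the
array `18`, whose contents are irrelevant. -/
theorem halts_euclidStep {s : Store L} {N : ℕ} {I : Ideal (OrePoly F L)}
    {A B S U : OrePoly F L} {Q : Store L → Prop} (h : EuclidState I N A B S U s)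
    (h11 : s.idx 11 = s.idx 10 - 1) (h10 : 1 ≤ s.idx 10) (hB : B.coeff (s.idx 11) ≠ 0)
    (hQ : ∀ (s' : Store L) (A' B' S' U' : OrePoly F L), EuclidState I N A' B' S' U' s' →
      s'.idx 9 = s.idx 10 → s'.idx 10 = s.idx 10 - 1 →
      (∀ c, c ≠ 7 → c ≠ 9 → c ≠ 14 → c ≠ 15 → c ≠ 17 → c ≠ 18 → c ≠ 19 → s'.val c = s.val c) →
      Q s') :
    HaltsWith euclidStep s ((s.idx 9 - s.idx 11 + 2) *
      (4 * arrayCost (Fintype.card F) N + 4)) Q := by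
  set W := arrayCost (Fintype.card F) N
  have hle := h.le
  have hN := h.le_N
  refine HaltsWith.mono (T := 1 + (W + ((s.idx 9 - s.idx 11 + 1) * (4 * W + 4) +
    (W + (W + (W + (1 + 1))))))) ?_ ?_ fun _ h => h
  swap
  · rw [show s.idx 9 - s.idx 11 + 2 = s.idx 9 - s.idx 11 + 1 + 1 from rfl,
      add_mul (s.idx 9 - s.idx 11 + 1) 1, one_mul]
    omega
  set b := s.idx 11 with hb
  have hb1 : b + 1 = s.idx 10 := by omega
  set B₁ := C F L (B.coeff b)⁻¹ * B with hB₁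
  have lB : B.LengthLe (b + 1) := h.length_B.mono (by omega)
  have lB₁ : B₁.LengthLe (b + 1) := lB.C_mul _
  refine HaltsWith.seq (HaltsWith.arith ?_)
  refine HaltsWith.seq (halts_scale (A := B) (B := B) (h.consts.congr rfl rfl rfl rfl)
    (by simp [h.val_B]) (by simp [h.val_B]) (lB.mono (by omega)) (lB.mono (by omega))
    (hQ := fun s1 c1 r1 i1 v1 => ?_))
  have r1' : s1.val 15 = B₁.coeff := by
    rw [r1, hB₁]
    simp [h.consts.3, FieldOp.eval, h.one, h.val_B, ← hb]
  refine HaltsWith.seq ?_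
  have e9 : s.idx 9 = s1.idx 9 := by simp [i1]
  rw [e9]
  refine halts_reduce (A := A) (B := B₁) (S := S) (U := U) (b := b) c1 rfl (by simp [i1, hb])
    (by simp [v1, h.val_A]) r1' (by simp [v1, h.val_S]) (by simp [v1, h.val_U])
    (by simp [v1, h.one]) (by simp [v1, h.neg_one]) (e9 ▸ h.length_A) lB₁ ?_ h.length_S
    h.length_U (by omega) (by omega) fun s2 A' S' U' c2 g14 g17 g18 lA' lS' lU' mA i2 v2 => ?_
  · rw [hB₁, coeff_C_mul, inv_mul_cancel₀ hB]
  refine HaltsWith.seq (halts_scale c2 g18 g14 lU' (lA'.mono (by omega))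
    (hQ := fun s3 c3 r3 i3 v3 => ?_))
  refine HaltsWith.seq (halts_scale (A := A') (B := B₁) c3 (by simp [v3, g14])
    (by simp [v3, v2, r1']) (lA'.mono (by omega)) (lB₁.mono (by omega))
    (hQ := fun s4 c4 r4 i4 v4 => ?_))
  have one2 : s2.val 16 0 = 1 := by simp [v2, v1, h.one]
  refine HaltsWith.seq (halts_scale (A := B₁) (B := A') c4 (by simp [v4, v3, v2, r1'])
    (by simp [v4, r3, c2.3, one2]) (lB₁.mono (by omega)) (lA'.mono (by omega))
    (hQ := fun s5 c5 r5 i5 v5 => ?_))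
  refine HaltsWith.seq (HaltsWith.idxAdd (HaltsWith.idxAdd ?_))
  have e10 : s5.idx 10 = s.idx 10 := by simp [i5, i4, i3, i2, i1]
  have e11 : s5.idx 11 = b := by simp [i5, i4, i3, i2, i1, hb]
  refine hQ _ B₁ A' S' A' ⟨c5.congr rfl rfl rfl rfl, ?_, ?_, ?_, ?_, ?_, ?_, ?_, ?_, ?_, ?_, ?_, ?_,
    lS', lA'.mono (by omega), ?_⟩ ?_ ?_ ?_
  · simp [v5, v4, v3, one2]
  · simp [v5, v4, v3, v2, v1, h.neg_one]
  · simp [v5, r4, c3.3, v3, one2]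
  · simp [r5, c4.3, v4, v3, one2]
  · simp [v5, v4, v3, g17]
  · simp [v5, v4, r3, c2.3, one2]
  · simp [c5.3, e10, h10]
  · simp [c5.3, e10, e11, ← hb1]
  · simp [c5.3, e10, hle.trans hN]
  · simpa [c5.3, e10, ← hb1] using lB₁
  · simp [c5.3, e10, ← hb1, hB₁, hB]
  · simpa [c5.3, e11] using lA'
  · rw [← h.span_eq]
    exact span_pair_eq (span_C_mul (inv_ne_zero hB) B) mA
  · simp [c5.3, e10]
  · simp [c5.3, e11, ← hb1]
  · intro c h1 h2 h3 h4 h5 h6 h7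
    simp [v5, v4, v3, v2, v1, h1, h2, h3, h4, h5, h6, h7]

/-- The potential is proportional to the sum of the two lengths. Only the length of `A` is exact;
that of `B` is an upper bound, so a vanishing top coefficient just shortens it. -/
theorem halts_euclid {s : Store L} {N : ℕ} {I : Ideal (OrePoly F L)}
    {A B S U : OrePoly F L} {Q : Store L → Prop} (h : EuclidState I N A B S U s)
    (hQ : ∀ (s' : Store L) (G : OrePoly F L), s'.HasConsts (Fintype.card F) N →
      s'.val 14 = G.coeff → 1 ≤ s'.idx 9 → s'.idx 9 ≤ N → G.LengthLe (s'.idx 9) →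
      G.coeff (s'.idx 9 - 1) = 1 → Ideal.span {G} = I →
      (∀ c, c ≠ 7 → c ≠ 9 → c ≠ 14 → c ≠ 15 → c ≠ 17 → c ≠ 18 → c ≠ 19 → s'.val c = s.val c) →
      Q s') :
    HaltsWith euclid s (1 + (s.idx 9 + s.idx 10) *
      (12 * arrayCost (Fintype.card F) N + 16)) Q := by
  set W := arrayCost (Fintype.card F) N
  refine HaltsWith.whileLt (fun s' => (∃ A B S U, EuclidState I N A B S U s') ∧
    ∀ c, c ≠ 7 → c ≠ 9 → c ≠ 14 → c ≠ 15 → c ≠ 17 → c ≠ 18 → c ≠ 19 → s'.val c = s.val c)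
    (fun s' => 1 + (s'.idx 9 + s'.idx 10) * (12 * W + 16)) (fun _ _ => Nat.le_add_right _ _)
    ?_ ⟨⟨A, B, S, U, h⟩, fun _ _ _ _ _ _ _ _ => rfl⟩ ?_
  · rintro s' ⟨⟨A, B, S, U, h⟩, hv⟩ hlt
    rw [h.consts.3] at hlt
    have hle := h.le
    obtain ⟨δ, hδ⟩ : ∃ δ, s'.idx 9 = s'.idx 10 + δ := ⟨_, (Nat.add_sub_of_le hle).symm⟩
    obtain ⟨e, he⟩ : ∃ e, s'.idx 10 = e + 1 := ⟨s'.idx 10 - 1, by omega⟩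
    have e11 : (s'.setIdx 11 (s'.idx 10 - s'.idx 2)).idx 11 = e := by
      simp [h.consts.2, he]
    have e9 : (s'.setIdx 11 (s'.idx 10 - s'.idx 2)).idx 9 = s'.idx 9 := by simp
    have e10 : (s'.setIdx 11 (s'.idx 10 - s'.idx 2)).idx 10 = s'.idx 10 := by simp
    have h1 : EuclidState I N A B S U (s'.setIdx 11 (s'.idx 10 - s'.idx 2)) :=
      ⟨h.consts.congr rfl rfl rfl rfl, h.2, h.3, h.4, h.5, h.6, h.7, h.8, h.9, h.10, h.11, h.12,
        h.13, h.14, h.15, h.16⟩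
    by_cases hz : B.coeff e = 0
    · refine ⟨1 + (1 + 1), HaltsWith.seq (HaltsWith.idxSub
        (HaltsWith.ifZero_true (by rwa [e11, Store.val_setIdx, h.val_B])
          (HaltsWith.idxAdd ⟨⟨⟨A, B, S, U, h.consts.congr rfl rfl rfl rfl, h.2, h.3, h.4, h.5,
            h.6, h.7, h.8, ?_, h.10, h.11, h.12, ?_, h.14, h.15, h.16⟩, hv⟩, ?_⟩)))⟩
      · simp [h.consts.2, h.consts.3]
        omega
      · intro i hi
        simp [h.consts.2, h.consts.3, he] at hi
        rcases hi.eq_or_lt with rfl | hi'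
        · exact hz
        · exact h.length_B i (by omega)
      · simp [h.consts.2, h.consts.3, hδ, he]
        nlinarith
    · refine ⟨1 + ((s'.idx 9 - e + 2) * (4 * W + 4) + 1), HaltsWith.seq (HaltsWith.idxSub
        (HaltsWith.ifZero_false (by rwa [e11, Store.val_setIdx, h.val_B]) ?_))⟩
      have hstep := halts_euclidStep (Q := fun s'' => ((∃ A B S U, EuclidState I N A B S U s'') ∧
        ∀ c, c ≠ 7 → c ≠ 9 → c ≠ 14 → c ≠ 15 → c ≠ 17 → c ≠ 18 → c ≠ 19 →
          s''.val c = s.val c) ∧ 1 + (s''.idx 9 + s''.idx 10) * (12 * W + 16) +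
          (1 + ((s'.idx 9 - e + 2) * (4 * W + 4) + 1)) + 1 ≤
            1 + (s'.idx 9 + s'.idx 10) * (12 * W + 16)) h1
        (by rw [e11, e10, he, Nat.add_sub_cancel]) (by omega) (by rwa [e11])
        (fun s'' A' B' S' U' h' g9 g10 hv' => ⟨⟨⟨A', B', S', U', h'⟩, fun c a1 a2 a3 a4 a5 a6 a7 =>
          (hv' c a1 a2 a3 a4 a5 a6 a7).trans (hv c a1 a2 a3 a4 a5 a6 a7)⟩, ?_⟩)
      · rw [e9, e11] at hstep
        exact hstep
      -- The sum of the lengths drops by `δ + 1` while the round costs about `(δ + 3) (4 W + 4)`.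
      -- The inequality `δ + 3 ≤ 3 (δ + 1)` explains the factor `12`.
      · rw [g9, g10, e10, hδ, he, Nat.add_sub_cancel, show e + 1 + δ - e = δ + 1 by omega]
        nlinarith
  · rintro s' ⟨⟨A, B, S, U, h⟩, hv⟩ hlt
    rw [h.consts.3, not_lt] at hlt
    -- The loop stops only when the length bound of `B` is `0`, so `A` alone generates the ideal.
    have hB : B = 0 := OrePoly.ext' fun i => h.length_B i (hlt.trans (Nat.zero_le i))
    refine hQ s' A h.consts h.val_A h.one_le h.le_N h.length_A h.monic_A ?_ hv
    rw [← h.span_eq, hB, Ideal.span_insert, Ideal.span_singleton_eq_bot.2 rfl, sup_bot_eq]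

end

/-! ## The program for `GroupAction` -/

/-- The constants: `N = 3 * d`, the scalars `1`, `-1` and `j⁻¹`, and the Ore polynomial `1`. -/
def setup : Prog :=
  .seq (.idxConst 2 1) <| .seq (.idxAdd 4 1 1) <| .seq (.idxAdd 4 4 1) <| .seq (.one 16 3) <|
    .seq (.arith .sub 16 2 20 3 16 3) <| .seq (.arith .div 10 3 16 3 0 3) (.one 11 3)

/-- Adds the terms of degree `k` of `u` and `v`, evaluated at `φ = j⁻¹ τ² + τ + w`, to the arrays
`3` and `4`, and multiplies the power `φ ^ k` in the array `11` by `φ`. -/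
def powerStep : Prog :=
  .seq (axpy 3 11 1 8) <| .seq (axpy 4 11 2 8) <| .seq (tauMul 12 11) <| .seq (tauMul 13 12) <|
    .seq (scale 11 11 0 2) <| .seq (axpy 11 12 16 3) (axpy 11 13 10 3)

/-- The first two lines of `GroupAction`. -/
def evaluate : Prog := .seq setup (forLoop 8 3 1 powerStep)

/-- The right greatest common divisor in `GroupAction`. -/
def computeGcd : Prog :=
  .seq (scale 14 4 16 2) <| .seq (.arith .add 14 1 14 1 16 3) <| .seq (scale 15 3 16 3) <|
    .seq (.idxAdd 9 1 2) <| .seq (.idxAdd 10 1 2) euclid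

/-- The last lines of `GroupAction`. -/
def computeResult : Prog :=
  .seq (scale 5 14 16 3) <| .seq (frobCell 0 2) <| .seq (.arith .sub 19 3 7 3 0 2) <|
    .seq (.arith .mul 19 3 14 2 19 3) <| .seq (.arith .add 19 3 14 3 19 3) <|
    .seq (frobCell 14 3) <| .seq (.arith .div 6 3 19 3 7 3) <|
    .seq (.copy 9 3 0 3) <| .seq (.idxSub 11 9 2) <|
    .seq (forLoop 8 3 11 (.seq (frobCell 9 3) (.copy 9 3 7 3))) <|
    .seq (.arith .div 6 2 16 3 9 3) <| .seq (frobCell 6 3) <| .seq (.arith .mul 7 3 7 3 6 3) <|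
    .seq (.idxAdd 11 2 2) (.arith .div 6 11 7 3 6 2)

/-- A program for `GroupAction`. -/
def groupAction : Prog := .seq evaluate <| .seq computeGcd computeResult

section

variable {F L : Type*} [Field F] [Fintype F] [Field L] [Algebra F L]
  {s : Store L} {Q : Store L → Prop} {d N : ℕ} {w j : L} {u v : Polynomial F}

open OrePoly

/-- The bound `N - 2` leaves room for the two multiplications by `τ`. These products are saved in
separate arrays before `X` is scaled in place. -/
theorem halts_powerStep {k : ℕ} {U V X P₁ P₂ : OrePoly F L}
    (hs : s.HasConsts (Fintype.card F) N) (h8 : s.idx 8 = k) (h3 : s.val 3 = U.coeff)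
    (h4 : s.val 4 = V.coeff) (h11 : s.val 11 = X.coeff) (h12 : s.val 12 = P₁.coeff)
    (h13 : s.val 13 = P₂.coeff) (h16 : s.val 16 0 = 1) (h10 : s.val 10 0 = j⁻¹)
    (h0 : s.val 0 1 = w) (lX : X.LengthLe (N - 2)) (lP₁ : P₁.LengthLe N) (lP₂ : P₂.LengthLe N)
    (hN : 2 ≤ N)
    (hQ : ∀ s' : Store L, s'.val 3 = (U + C F L (s.val 1 k) * X).coeff →
      s'.val 4 = (V + C F L (s.val 2 k) * X).coeff → s'.val 11 = (phiX j w * X).coeff →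
      s'.val 12 = (tau F L * X).coeff → s'.val 13 = (tau F L * (tau F L * X)).coeff → Q s') :
    HaltsWith powerStep s (7 * arrayCost (Fintype.card F) N) Q := by
  set W := arrayCost (Fintype.card F) N
  have lX0 : X.LengthLe N := lX.mono (by omega)
  have lX1 : (tau F L * X).LengthLe N := lX.tau_mul.mono (by omega)
  have lX2 : (tau F L * (tau F L * X)).LengthLe N := lX.tau_mul.tau_mul.mono (by omega)
  refine HaltsWith.mono (T := W + (W + (W + (W + (W + (W + W)))))) ?_ (by omega) fun _ h => h
  refine HaltsWith.seq (halts_axpy hs h3 h11 lX0 (hQ := fun s1 c1 r1 i1 v1 => ?_))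
  refine HaltsWith.seq (halts_axpy (A := V) (B := X) c1 (by simp [v1, h4]) (by simp [v1, h11])
    lX0 (hQ := fun s2 c2 r2 i2 v2 => ?_))
  refine HaltsWith.seq (halts_tauMul (A := X) (B := P₁) c2 (by simp [v2, v1, h11])
    (by simp [v2, v1, h12]) lX0 (lP₁.mono (by omega)) (hQ := fun s3 c3 r3 i3 v3 => ?_))
  refine HaltsWith.seq (halts_tauMul (B := P₂) c3 r3 (by simp [v3, v2, v1, h13]) lX1
    (lP₂.mono (by omega)) (hQ := fun s4 c4 r4 i4 v4 => ?_))
  refine HaltsWith.seq (halts_scale (A := X) (B := X) c4 (by simp [v4, v3, v2, v1, h11])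
    (by simp [v4, v3, v2, v1, h11]) lX0 lX0 (hQ := fun s5 c5 r5 i5 v5 => ?_))
  refine HaltsWith.seq (halts_axpy (B := tau F L * X) c5 r5 (by simp [v5, v4, r3]) lX1
    (hQ := fun s6 c6 r6 i6 v6 => ?_))
  refine halts_axpy (B := tau F L * (tau F L * X)) c6 r6 (by simp [v6, v5, r4]) lX2
    (hQ := fun s7 c7 r7 i7 v7 => hQ s7 ?_ ?_ ?_ ?_ ?_)
  · simp only [ne_eq, v7, v6, v5, v4, v3, v2, r1, h8, Nat.reduceEqDiff, not_false_eq_true]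
  · simp [v7, v6, v5, v4, v3, r2, i1, h8, v1]
  · rw [r7, phiX_mul]
    simp [c4.2, c5.3, c6.3, v6, v5, v4, v3, v2, v1, h16, h10, h0]
  · simp [v7, v6, v5, v4, r3]
  · simp [v7, v6, v5, r4]

theorem halts_setup
    (hQ : ∀ s' : Store L, s'.HasConsts (Fintype.card F) (3 * d) → s'.idx 1 = d →
      s'.val 16 0 = 1 → s'.val 16 1 = -1 → s'.val 10 0 = j⁻¹ →
      s'.val 11 = (1 : OrePoly F L).coeff →
      (∀ c, c ≠ 10 → c ≠ 11 → c ≠ 16 → s'.val c = (inputStore d w j u v).val c) → Q s') :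
    HaltsWith setup (inputStore d w j u v) 7 Q := by
  refine HaltsWith.mono (T := 1 + (1 + (1 + (1 + (1 + (1 + 1)))))) ?_ le_rfl fun _ h => h
  refine HaltsWith.seq (HaltsWith.idxConst (HaltsWith.seq (HaltsWith.idxAdd
    (HaltsWith.seq (HaltsWith.idxAdd ?_)))))
  generalize hs1 : Store.setIdx _ 4 _ = s1
  have c1 : s1.HasConsts (Fintype.card F) (3 * d) := by
    subst hs1
    refine ⟨?_, ?_, ?_, ?_⟩ <;> simp [inputStore]
    omega
  have e1 : s1.idx 1 = d := by simp [← hs1, inputStore]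
  have v1 : s1.val = (inputStore d w j u v).val := by simp [← hs1]
  refine HaltsWith.seq (HaltsWith.one (HaltsWith.seq (HaltsWith.arith
    (HaltsWith.seq (HaltsWith.arith (HaltsWith.one (hQ _ ?_ ?_ ?_ ?_ ?_ ?_ ?_)))))))
  · exact c1.congr rfl rfl rfl rfl
  · exact e1
  · simp [c1.2, c1.3]
  · simp [c1.2, c1.3, v1, inputStore, FieldOp.eval]
  · simp [c1.2, c1.3, v1, inputStore, FieldOp.eval]
  · funext i
    rcases Nat.eq_zero_or_pos i with rfl | h
    · simp [c1.3, coeff_one]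
    · simp [c1.3, v1, inputStore, coeff_one, h.ne, h.ne']
  · intro c h10 h11 h16
    simp [h10, h11, h16, v1]

theorem halts_evaluate (hd : 5 ≤ d) (hu : u.natDegree < d) (hv : v.natDegree < d)
    (hQ : ∀ s' : Store L, s'.HasConsts (Fintype.card F) (3 * d) → s'.idx 1 = d →
      s'.val 3 = (Polynomial.aeval (phiX (F := F) j w) u).coeff →
      s'.val 4 = (Polynomial.aeval (phiX (F := F) j w) v).coeff →
      s'.val 16 0 = 1 → s'.val 16 1 = -1 → s'.val 0 0 = j → s'.val 0 1 = w →
      (∀ c, c = 5 ∨ c = 14 ∨ c = 15 ∨ c = 17 ∨ c = 18 → s'.val c = (0 : OrePoly F L).coeff) →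
      Q s') :
    HaltsWith evaluate (inputStore d w j u v)
      (9 + d * (7 * arrayCost (Fintype.card F) (3 * d) + 2)) Q := by
  set W := arrayCost (Fintype.card F) (3 * d)
  refine HaltsWith.mono (T := 7 + (2 + d * (7 * W + 2))) ?_ (by omega) fun _ h => h
  refine HaltsWith.seq (halts_setup fun s1 c1 e1 g16 g16' g10 g11 gc => ?_)
  have gz : ∀ c, c ≠ 0 → c ≠ 1 → c ≠ 2 → c ≠ 10 → c ≠ 11 → c ≠ 16 →
      s1.val c = (0 : OrePoly F L).coeff := by
    intro c h0 h1 h2 h10 h11 h16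
    rw [gc c h10 h11 h16]
    funext i
    simp [inputStore, h0, h1, h2]
  have hcount : s1.idx 1 - s1.idx 3 = d := by rw [e1, c1.3, Nat.sub_zero]
  rw [show 2 + d * (7 * W + 2) = 2 + (s1.idx 1 - s1.idx 3) * (7 * W + 2) by rw [hcount]]
  have hout : ∀ s' : Store L, (∀ a ∉ powerStep.valWrites, s'.val a = s1.val a) →
      ∀ c, c ≠ 3 → c ≠ 4 → c ≠ 7 → c ≠ 9 → c ≠ 11 → c ≠ 12 → c ≠ 13 →
        s'.val c = s1.val c := by
    intro s' h c h3 h4 h7 h9 h11 h12 h13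
    refine h c ?_
    simp [powerStep, axpy, axpyLoop, scale, scaleLoop, tauMul, frobCell, forLoop,
      Prog.valWrites, h3, h4, h7, h9, h11, h12, h13]
  refine HaltsWith.forLoop (T := 7 * W) (fun k x => ∃ P₁ P₂ : OrePoly F L,
    x 3 = (∑ i ∈ Finset.range k,
      C F L (algebraMap F L (u.coeff i)) * phiX j w ^ i : OrePoly F L).coeff ∧
    x 4 = (∑ i ∈ Finset.range k,
      C F L (algebraMap F L (v.coeff i)) * phiX j w ^ i : OrePoly F L).coeff ∧
    x 11 = (phiX j w ^ k : OrePoly F L).coeff ∧ x 12 = P₁.coeff ∧ x 13 = P₂.coeff ∧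
    P₁.LengthLe (3 * d) ∧ P₂.LengthLe (3 * d)) c1.2 c1.3 (by omega) (by decide) (by decide)
    (by decide) (by decide) (by decide) ?_ ?_ ?_
  · rw [c1.3]
    refine ⟨0, 0, ?_, ?_, ?_, ?_, ?_, LengthLe.zero _, LengthLe.zero _⟩
    · simp [gz]
    · simp [gz]
    · simpa using g11
    · simp [gz]
    · simp [gz]
  · rintro k s' - hk h8 hidx hval ⟨P₁, P₂, q3, q4, q11, q12, q13, l₁, l₂⟩
    rw [e1] at hk
    have hval' := hout s' hval
    -- For `k < d` this gives length at most `2 d - 1 ≤ 3 d - 2`, which is why `N = 3 d` is large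
    -- enough.
    have lX := LengthLe.phiX_pow (F := F) j w k
    refine halts_powerStep (c1.congr (hidx 0 (by decide) (by decide))
      (hidx 2 (by decide) (by decide)) (hidx 3 (by decide) (by decide))
      (hidx 4 (by decide) (by decide))) h8 q3 q4 q11 q12 q13 (j := j) (w := w) ?_ ?_ ?_
      (lX.mono (by omega)) l₁ l₂ (by omega) fun s'' p3 p4 p11 p12 p13 =>
        ⟨_, _, ?_, ?_, ?_, p12, p13, lX.tau_mul.mono (by omega),
          lX.tau_mul.tau_mul.mono (by omega)⟩
    · simp [hval', g16]
    · simp [hval', g10]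
    · simp [hval', gc, inputStore]
    · rw [p3, Finset.sum_range_succ]
      simp [hval', gc, inputStore]
    · rw [p4, Finset.sum_range_succ]
      simp [hval', gc, inputStore]
    · rw [p11, pow_succ']
  · rintro s' hidx hval ⟨P₁, P₂, q3, q4, q11, -⟩
    have hval' := hout s' hval
    rw [e1] at q3 q4
    refine hQ s' (c1.congr (hidx 0 (by decide) (by decide))
      (hidx 2 (by decide) (by decide)) (hidx 3 (by decide) (by decide))
      (hidx 4 (by decide) (by decide))) ((hidx 1 (by decide) (by decide)).trans e1)
      (by rw [q3, aeval_eq_sum _ u d hu]) (by rw [q4, aeval_eq_sum _ v d hv]) ?_ ?_ ?_ ?_ ?_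
    · simp [hval', g16]
    · simp [hval', g16']
    · simp [hval', gc, inputStore]
    · simp [hval', gc, inputStore]
    · rintro c (rfl | rfl | rfl | rfl | rfl) <;> simp [hval', gz]

/-- The Euclidean algorithm starts from `τ ^ d - V`, obtained by negating `V` and adding `1` to cell
`d`, and from `U`, both with length bound `d + 1`; the initial potential is thus linear in `d`. -/
theorem halts_computeGcd {U V : OrePoly F L} (hd : 5 ≤ d)
    (hs : s.HasConsts (Fintype.card F) (3 * d)) (h1 : s.idx 1 = d) (h3 : s.val 3 = U.coeff)
    (h4 : s.val 4 = V.coeff) (h16 : s.val 16 0 = 1) (h16' : s.val 16 1 = -1)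
    (hz : ∀ c, c = 14 ∨ c = 15 ∨ c = 17 ∨ c = 18 → s.val c = (0 : OrePoly F L).coeff)
    (lU : U.LengthLe d) (lV : V.LengthLe d)
    (hQ : ∀ (s' : Store L) (G : OrePoly F L), s'.HasConsts (Fintype.card F) (3 * d) →
      s'.val 14 = G.coeff → 1 ≤ s'.idx 9 → s'.idx 9 ≤ 3 * d → G.LengthLe (s'.idx 9) →
      G.coeff (s'.idx 9 - 1) = 1 → Ideal.span {G} = Ideal.span {U, tau F L ^ d - V} →
      (∀ c, c ≠ 7 → c ≠ 9 → c ≠ 14 → c ≠ 15 → c ≠ 17 → c ≠ 18 → c ≠ 19 → s'.val c = s.val c) →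
      Q s') :
    HaltsWith computeGcd s (2 * arrayCost (Fintype.card F) (3 * d) + 4 +
      2 * (d + 1) * (12 * arrayCost (Fintype.card F) (3 * d) + 16)) Q := by
  set W := arrayCost (Fintype.card F) (3 * d)
  refine HaltsWith.mono (T := W + (1 + (W + (1 + (1 + (1 + 2 * (d + 1) * (12 * W + 16)))))))
    ?_ (by omega) fun _ h => h
  refine HaltsWith.seq (halts_scale (A := 0) (B := V) hs (by simp [hz]) h4 (LengthLe.zero _)
    (lV.mono (by omega)) (hQ := fun s1 c1 r1 i1 v1 => ?_))
  refine HaltsWith.seq (HaltsWith.arith ?_)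
  refine HaltsWith.seq (halts_scale (A := 0) (B := U) (c1.congr rfl rfl rfl rfl)
    (by simp [v1, hz]) (by simp [v1, h3]) (LengthLe.zero _)
    (lU.mono (by omega)) (hQ := fun s2 c2 r2 i2 v2 => ?_))
  refine HaltsWith.seq (HaltsWith.idxAdd (HaltsWith.seq (HaltsWith.idxAdd ?_)))
  have e1 : s2.idx 1 = d := by simp [i2, i1, h1]
  generalize hs3 : Store.setIdx _ 10 _ = s3
  have e9 : s3.idx 9 = d + 1 := by simp [← hs3, e1, c2.2]
  have e10 : s3.idx 10 = d + 1 := by simp [← hs3, e1, c2.2]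
  have v3 : s3.val = s2.val := by simp [← hs3]
  have lA : (tau F L ^ d - V).LengthLe (d + 1) := (LengthLe.tau_pow d).sub (lV.mono (by omega))
  have hstate : EuclidState (Ideal.span {U, tau F L ^ d - V}) (3 * d) (tau F L ^ d - V) U 0 0
      s3 := by
    refine ⟨?_, ?_, ?_, ?_, ?_, ?_, ?_, ?_, ?_, ?_, ?_, ?_, ?_, LengthLe.zero _, LengthLe.zero _,
      ?_⟩
    · refine c2.congr ?_ ?_ ?_ ?_ <;> simp [← hs3]
    · simp [v3, v2, v1, h16]
    · simp [v3, v2, v1, h16']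
    · funext i
      by_cases hi : i = d
      · subst hi
        simp [v3, v2, i1, h1, hs.3, FieldOp.eval, r1, v1, h16, hs.2, h16', coeff_tau_pow]
        ring
      · simp [v3, v2, i1, h1, r1, hs.2, h16', coeff_tau_pow, Ne.symm hi, hi]
    · simp [v3, r2, c1.3, v1, h16]
    · simp [v3, v2, v1, hz]
    · simp [v3, v2, v1, hz]
    · omega
    · omega
    · omega
    · rw [e9]
      exact lA
    · rw [e9, Nat.add_sub_cancel, coeff_sub, coeff_tau_pow, if_pos rfl, lV d le_rfl, sub_zero]
    · rw [e10]
      exact lU.mono (by omega)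
    · rw [Set.pair_comm]
  have := halts_euclid (Q := Q) hstate fun s' G g1 g2 g3 g4 g5 g6 g7 g8 =>
    hQ s' G g1 g2 g3 g4 g5 g6 g7 fun c a1 a2 a3 a4 a5 a6 a7 => by
      rw [g8 c a1 a2 a3 a4 a5 a6 a7, v3, v2 c a1 a2 a4, Store.val_setVal, if_neg a3,
        v1 c a1 a2 a3]
  rwa [e9, e10, show d + 1 + (d + 1) = 2 * (d + 1) by ring] at this

/-- The index variable `9` holds the length of the monic gcd, so one less is its `τ`-degree and the
number of successive Frobenius powers applied to `j`. -/
theorem halts_computeResult {G : OrePoly F L} (hN : 1 ≤ N)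
    (hs : s.HasConsts (Fintype.card F) N) (h14 : s.val 14 = G.coeff)
    (h5 : s.val 5 = (0 : OrePoly F L).coeff) (h16 : s.val 16 0 = 1) (h0 : s.val 0 0 = j)
    (h0' : s.val 0 1 = w) (lG : G.LengthLe N) (h9 : s.idx 9 ≤ N)
    (hQ : ∀ s' : Store L, s'.val 3 = s.val 3 → s'.val 4 = s.val 4 → s'.val 5 = G.coeff →
      s'.val 6 0 = (G.coeff 0 ^ Fintype.card F)⁻¹ *
        (G.coeff 0 + G.coeff 1 * (w ^ Fintype.card F - w)) →
      s'.val 6 1 = (j ^ (Fintype.card F ^ (s.idx 9 - 1)))⁻¹ →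
      s'.val 6 2 = s'.val 6 0 ^ (Fintype.card F + 1) / s'.val 6 1 → Q s') :
    HaltsWith computeResult s (6 * arrayCost (Fintype.card F) N + 11) Q := by
  set q := Fintype.card F
  set W := arrayCost q N with hW
  set n := s.idx 9 - 1
  have hfrob : 3 * q + 3 ≤ W := by
    have h := Nat.mul_le_mul_right (3 * q + 7) hN
    rw [hW, arrayCost]
    omega
  refine HaltsWith.mono (T := W + (3 * q + 3 + (1 + (1 + (1 + (3 * q + 3 + (1 + (1 + (1 +
    (2 + n * (3 * q + 4 + 2) + (1 + (3 * q + 3 + (1 + (1 + 1)))))))))))))) ?_ ?_ fun _ h => h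
  swap
  · have h1 : n * (3 * q + 4 + 2) ≤ N * (3 * q + 7) := Nat.mul_le_mul (by omega) (by omega)
    have h2 : W = N * (3 * q + 7) + 3 := rfl
    omega
  refine HaltsWith.seq (halts_scale (A := 0) (B := G) hs h5 h14 (LengthLe.zero _) lG
    (hQ := fun s1 c1 r1 i1 v1 => ?_))
  have r1' : s1.val 5 = G.coeff := by simp [r1, hs.3, h16]
  refine HaltsWith.seq (halts_frobCell c1 (by decide) (by decide) fun s2 r2 i2 v2 => ?_)
  have c2 : s2.HasConsts q N := c1.congr (i2 _ (by decide)) (i2 _ (by decide))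
    (i2 _ (by decide)) (i2 _ (by decide))
  refine HaltsWith.seq (HaltsWith.arith (HaltsWith.seq (HaltsWith.arith
    (HaltsWith.seq (HaltsWith.arith ?_)))))
  refine HaltsWith.seq (halts_frobCell (c2.congr rfl rfl rfl rfl) (by decide) (by decide)
    fun s3 r3 i3 v3 => ?_)
  have c3 : s3.HasConsts q N := c2.congr (i3 _ (by decide)) (i3 _ (by decide))
    (i3 _ (by decide)) (i3 _ (by decide))
  have e19 : s3.val 19 0 = G.coeff 0 + G.coeff 1 * (w ^ q - w) := by
    simp [v3, v2, v1, c2.3, c2.2, c1.2, r2, FieldOp.eval, h0', h14]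
  have e7 : s3.val 7 0 = G.coeff 0 ^ q := by
    simp [r3, v2, v1, c2.3, h14]
  refine HaltsWith.seq (HaltsWith.arith (HaltsWith.seq (HaltsWith.copy
    (HaltsWith.seq (HaltsWith.idxSub (HaltsWith.seq ?_))))))
  generalize hs4 : Store.setIdx _ 11 _ = s4
  have c4 : s4.HasConsts q N := by
    subst hs4
    exact c3.congr rfl rfl rfl rfl
  have e6 : s4.val 6 0 = (G.coeff 0 ^ q)⁻¹ * (G.coeff 0 + G.coeff 1 * (w ^ q - w)) := by
    simp [← hs4, c3.3, FieldOp.eval, e19, e7, div_eq_inv_mul]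
  have e9 : s4.val 9 0 = j := by
    simp [← hs4, c3.3, v3, v2, v1, h0]
  have e11 : s4.idx 11 = n := by
    simp [← hs4, c3.2, i3, i2, i1, n]
  have v4 : ∀ c, c ≠ 5 → c ≠ 6 → c ≠ 7 → c ≠ 9 → c ≠ 19 → s4.val c = s.val c := by
    intro c h5 h6 h7 h9 h19
    simp [← hs4, v3, v2, v1, h5, h6, h7, h9, h19]
  have v4' : s4.val 5 = G.coeff := by simp [← hs4, v3, v2, r1']
  clear_value n
  subst e11
  rw [show s4.idx 11 * (3 * q + 4 + 2) = (s4.idx 11 - s4.idx 3) * (3 * q + 4 + 2) by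
    rw [c4.3, Nat.sub_zero]]
  refine HaltsWith.forLoop (T := 3 * q + 4) (fun k x => x 9 0 = j ^ q ^ k) c4.2 c4.3
    (by rw [c4.3]; exact Nat.zero_le _) (by decide) (by decide) (by decide) (by decide)
    (by decide) ?_ ?_ ?_
  · simp [c4.3, e9]
  · intro k s' _ _ h8 hidx hval hI
    have c' : s'.HasConsts q N := c4.congr (hidx _ (by decide) (by decide))
      (hidx _ (by decide) (by decide)) (hidx _ (by decide) (by decide))
      (hidx _ (by decide) (by decide))
    refine HaltsWith.seq (T := 3 * q + 3) (T' := 1) (halts_frobCell c' (by decide) (by decide)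
      fun s'' r'' i'' v'' => HaltsWith.copy ?_)
    have e3 : s''.idx 3 = 0 := by simp [i'', c'.3]
    simp [e3, r'', c'.3, hI, pow_succ, pow_mul]
  · intro s5 hidx hval hI
    have c5 : s5.HasConsts q N := c4.congr (hidx _ (by decide) (by decide))
      (hidx _ (by decide) (by decide)) (hidx _ (by decide) (by decide))
      (hidx _ (by decide) (by decide))
    have v5 : ∀ c, c ≠ 7 → c ≠ 9 → s5.val c = s4.val c := fun c h7 h9 =>
      hval c (by simp [frobCell, forLoop, Prog.valWrites, h7, h9])
    refine HaltsWith.seq (HaltsWith.arith ?_)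
    refine HaltsWith.seq (halts_frobCell (c5.congr rfl rfl rfl rfl) (by decide) (by decide)
      fun s6 r6 i6 v6 => ?_)
    refine HaltsWith.seq (HaltsWith.arith (HaltsWith.seq (HaltsWith.idxAdd
      (HaltsWith.arith (hQ _ ?_ ?_ ?_ ?_ ?_ ?_)))))
    all_goals simp [v6, v5, v4, v4', i6, c5.2, c5.3, FieldOp.eval, e6, hI, r6, h16, pow_succ]

theorem halts_groupAction (hd : 5 ≤ d) (hu : 2 * u.natDegree + 1 ≤ d)
    (hv : 2 * v.natDegree + 1 ≤ d) :
    ∃ (T : GroupActionRun F L) (s : Store L) (t : ℕ), T.IsRunOn d w j u v ∧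
      Exec groupAction (inputStore d w j u v) s t ∧ s.Holds T ∧
      t ≤ 5000 * (Fintype.card F + 3) * d ^ 2 := by
  set q := Fintype.card F with hq
  set W := arrayCost q (3 * d) with hW
  set U : OrePoly F L := Polynomial.aeval (phiX j w) u
  set V : OrePoly F L := Polynomial.aeval (phiX j w) v
  have key : HaltsWith groupAction (inputStore d w j u v) (5000 * (q + 3) * d ^ 2)
      fun s => ∃ T : GroupActionRun F L, T.IsRunOn d w j u v ∧ s.Holds T := by
    refine HaltsWith.mono (T := 9 + d * (7 * W + 2) + ((2 * W + 4 +
      2 * (d + 1) * (12 * W + 16)) + (6 * W + 11))) ?_ ?_ fun _ h => h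
    swap
    · have h1 : W = 3 * d * (3 * q + 7) + 3 := rfl
      rw [h1]
      nlinarith [Nat.mul_le_mul hd hd, Nat.zero_le (q * d), Nat.mul_le_mul_left (q * d) hd,
        Nat.mul_le_mul_left d hd]
    refine HaltsWith.seq (halts_evaluate hd (by omega) (by omega)
      fun s1 c1 e1 g3 g4 g16 g16' g0 g0' gz => ?_)
    refine HaltsWith.seq (halts_computeGcd hd c1 e1 g3 g4 g16 g16'
      (fun c hc => gz c (Or.inr hc)) ((LengthLe.aeval_phiX j w u le_rfl).mono hu)
      ((LengthLe.aeval_phiX j w v le_rfl).mono hv)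
      fun s2 G c2 k14 k1 kN lG mG hspan v2 => ?_)
    refine halts_computeResult (by omega) c2 k14 (j := j) (w := w) ?_ ?_ ?_ ?_ (lG.mono kN) kN
      fun s3 p3 p4 p5 p60 p61 p62 => ?_
    · simp [v2, gz]
    · simp [v2, g16]
    · simp [v2, g0]
    · simp [v2, g0']
    -- The leading coefficient `1` turns the stored length into the true degree, which both monicity
    -- and the exponent of `j` refer to.
    have hdeg : G.tauDegree = s2.idx 9 - 1 :=
      LengthLe.tauDegree_eq (by rwa [Nat.sub_add_cancel k1]) (by rw [mG]; exact one_ne_zero)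
    refine ⟨⟨U, V, G, s3.val 6 0, s3.val 6 1, s3.val 6 2⟩, ⟨rfl, rfl, ⟨?_, hspan.symm⟩, p60, ?_,
      p62⟩, ⟨fun i => ?_, fun i => ?_, fun i => ?_, rfl, rfl, rfl⟩⟩
    · rw [Monic, hdeg, mG]
    · rw [hdeg, p61]
    · rw [p3, v2 3 (by decide) (by decide) (by decide) (by decide) (by decide) (by decide)
        (by decide), g3]
    · rw [p4, v2 4 (by decide) (by decide) (by decide) (by decide) (by decide) (by decide)
        (by decide), g4]
    · rw [p5]
  obtain ⟨s, t, he, ht, T, hT, hs⟩ := key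
  exact ⟨T, s, t, hT, he, hs, ht⟩

end

/-! ## Feasible exponents are at least two -/

section

variable {K : Type*} [Field K]

theorem length_runSL (cs : List (SLInstr K)) (l : List K) :
    (runSL cs l).length = l.length + cs.length := by
  induction cs generalizing l with
  | nil => rfl
  | cons c cs ih =>
    rw [runSL, ih, List.length_append, List.length_singleton, List.length_cons, add_assoc,
      add_comm 1]

theorem getD_runSL (cs : List (SLInstr K)) (l : List K) {i : ℕ} (hi : i < l.length) :
    (runSL cs l).getD i 0 = l.getD i 0 := by
  induction cs generalizing l with
  | nil => rfl
  | cons c cs ih =>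
    rw [runSL, ih _ (by simp; omega), List.getD_append _ _ _ _ hi]

theorem length_matrixEntries {K : Type*} {n : ℕ} (A : Matrix (Fin n) (Fin n) K) :
    (matrixEntries A).length = n * n := List.length_ofFn

theorem getD_matrixEntries_const {n i : ℕ} (c : K) (hi : i < n * n) :
    (matrixEntries (Matrix.of fun _ _ : Fin n => c)).getD i 0 = c := by
  simp [matrixEntries, hi]

/-- The map from entries to output positions is injective and takes values among the positions
appended by the program. -/
theorem MultipliesMatrices.sq_le_length {n : ℕ} {cs : List (SLInstr K)}
    (h : MultipliesMatrices n cs) : n * n ≤ cs.length := by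
  obtain ⟨out, h⟩ := h
  have hunit : ∀ i k i' k' : Fin n,
      (Matrix.single i i (1 : K) * Matrix.single i k (1 : K) : Matrix (Fin n) (Fin n) K) i' k' =
        if i = i' ∧ k = k' then 1 else 0 := by
    intro i k i' k'
    rw [Matrix.single_mul_single_same, mul_one, Matrix.single_apply]
  have hlen : ∀ A B : Matrix (Fin n) (Fin n) K,
      (matrixEntries A ++ matrixEntries B).length = n * n + n * n := fun A B => by
    rw [List.length_append, length_matrixEntries, length_matrixEntries]
  have hinj : Function.Injective fun x : Fin n × Fin n => out x.1 x.2 := by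
    rintro ⟨i, k⟩ ⟨i', k'⟩ hik
    -- This product of matrix units has a single nonzero entry, at `(i, k)`; a position shared with
    -- another entry would have to hold both `1` and `0`.
    have h1 := h (Matrix.single i i 1) (Matrix.single i k 1) i k
    have h2 := h (Matrix.single i i 1) (Matrix.single i k 1) i' k'
    rw [hunit] at h1 h2
    simp only at hik
    rw [← hik, h1, if_pos ⟨rfl, rfl⟩] at h2
    by_contra hne
    rw [if_neg (by rintro ⟨rfl, rfl⟩; exact hne rfl)] at h2
    exact one_ne_zero h2
  have hmem : ∀ x : Fin n × Fin n,
      out x.1 x.2 ∈ Finset.Ico (n * n + n * n) (n * n + n * n + cs.length) := by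
    rintro ⟨i, k⟩
    rw [Finset.mem_Ico]
    constructor
    · by_contra hlt
      rw [not_le] at hlt
      -- An output position inside one of the inputs is excluded by filling that input with ones and
      -- the other with zeros: the cell holds `1`, the product is `0`.
      rcases lt_or_ge (out i k) (n * n) with h1 | h1
      · have h2 := h (Matrix.of fun _ _ => 1) 0 i k
        rw [getD_runSL _ _ (by rwa [hlen]), List.getD_append _ _ _ _
          (by rwa [length_matrixEntries]), getD_matrixEntries_const 1 h1] at h2
        simp at h2
      · have h2 := h 0 (Matrix.of fun _ _ => 1) i k
        rw [getD_runSL _ _ (by rwa [hlen]), List.getD_append_right _ _ _ _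
          (by rwa [length_matrixEntries]), length_matrixEntries,
          getD_matrixEntries_const 1 (by simp only at hlt; omega)] at h2
        simp at h2
    -- Beyond the end of the list the default value `0` is read, whereas some product has entry `1`
    -- there.
    · by_contra hge
      have h2 := h (Matrix.single i i 1) (Matrix.single i k 1) i k
      rw [hunit, if_pos ⟨rfl, rfl⟩, List.getD_eq_default _ _
        (by rw [length_runSL, hlen]; exact not_lt.1 hge)] at h2
      exact zero_ne_one h2
  have hcard := Finset.card_le_card_of_injOn (s := Finset.univ) _ (fun x _ => hmem x) hinj.injOn
  simpa using hcard

/-- For `ω < 2`, the inequality `n² ≤ c n ^ ω` would bound the unbounded sequence `n ^ (2 - ω)` by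
`c`. -/
theorem IsFeasibleExponent.two_le {ω : ℝ} (h : IsFeasibleExponent K ω) : 2 ≤ ω := by
  obtain ⟨c, h⟩ := h
  by_contra hlt
  have htend := (tendsto_rpow_atTop (sub_pos.2 (not_le.1 hlt))).comp tendsto_natCast_atTop_atTop
  obtain ⟨n, hn, hc⟩ := ((Filter.eventually_ge_atTop 1).and
    (htend.eventually_gt_atTop c)).exists
  obtain ⟨cs, hcs, hle⟩ := h n hn
  have hpos : (0 : ℝ) < n := by exact_mod_cast hn
  have h1 : ((n * n : ℕ) : ℝ) ≤ c * (n : ℝ) ^ ω :=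
    (Nat.cast_le.2 hcs.sq_le_length).trans hle
  have h2 : ((n * n : ℕ) : ℝ) = (n : ℝ) ^ (2 - ω) * (n : ℝ) ^ ω := by
    rw [← Real.rpow_add hpos, sub_add_cancel, Real.rpow_two, Nat.cast_mul, pow_two]
  rw [h2] at h1
  exact absurd (le_of_mul_le_mul_right h1 (Real.rpow_pos_of_pos hpos ω)) (not_le.2 hc)

end

/-! ### Degrees of Mumford coordinates and the final estimate -/

theorem IsMumford.two_mul_natDegree_lt {F : Type*} [Field F] {d : ℕ} {h f u v : Polynomial F}
    (huv : IsMumford d h f u v) (hd : 1 ≤ d) :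
    2 * u.natDegree + 1 ≤ d ∧ 2 * v.natDegree + 1 ≤ d := by
  have h1 := huv.natDegree_le
  have h2 := Polynomial.natDegree_le_natDegree huv.degree_lt.le
  omega

/-- There is one program that carries out the algorithm `GroupAction` on every valid input, and
its number of steps (all arithmetic operations in `L` included) is `Õ_q(d ^ ((ω + 3) / 2))` for
every feasible exponent `ω` for matrix multiplication over the field with `q` elements. -/
theorem mainTheorem5 :
    ∃ (P : Prog) (k : ℕ), ∀ (q : ℕ) (ω : ℝ), ∃ c : ℝ,
      ∀ (F : Type*) [Field F] [Fintype F], Fintype.card F = q → IsFeasibleExponent F ω →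
      ∀ (d m : ℕ) (α : F) (p h : Polynomial F), IsCurveDatum d m α p h →
      ∀ (L : Type*) [Field L] [Algebra F L], Module.finrank F L = d →
      ∀ γ : CoordRing h (Polynomial.C α * p ^ m) →ₐ[F] L,
        RingHom.ker γ = Ideal.span {CoordRing.ofX p, CoordRing.Y} →
      ∀ (j : L) (u v : Polynomial F), IsJInvariant γ j →
        IsMumford d h (Polynomial.C α * p ^ m) u v →
      ∃ (T : GroupActionRun F L) (s : Store L) (t : ℕ),
        T.IsRunOn d (γ (CoordRing.ofX Polynomial.X)) j u v ∧
        Exec P (inputStore d (γ (CoordRing.ofX Polynomial.X)) j u v) s t ∧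
        s.Holds T ∧
        (t : ℝ) ≤ c * (d : ℝ) ^ ((ω + 3) / 2) * Real.log d ^ k := by
  refine ⟨groupAction, 0, fun q ω => ⟨5000 * (q + 3), ?_⟩⟩
  intro F _ _ hq hω d m α p h hcurve L _ _ _ γ _ j u v _ huv
  have hd := hcurve.five_le
  obtain ⟨hu, hv⟩ := huv.two_mul_natDegree_lt (by omega)
  obtain ⟨T, s, t, hT, he, hs, ht⟩ :=
    halts_groupAction (w := γ (CoordRing.ofX Polynomial.X)) (j := j) hd hu hv
  refine ⟨T, s, t, hT, he, hs, ?_⟩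
  have hd1 : (1 : ℝ) ≤ d := by exact_mod_cast (by omega : 1 ≤ d)
  -- Matrix multiplication enters only here, through `ω ≥ 2`, which makes the exponent at least `2`.
  have hpow : (d : ℝ) ^ 2 ≤ (d : ℝ) ^ ((ω + 3) / 2) := by
    rw [← Real.rpow_two]
    exact Real.rpow_le_rpow_of_exponent_le hd1 (by linarith [hω.two_le])
  have ht' : (t : ℝ) ≤ 5000 * (q + 3) * (d : ℝ) ^ 2 := by
    rw [hq] at ht
    exact_mod_cast ht
  rw [pow_zero, mul_one]
  exact ht'.trans (mul_le_mul_of_nonneg_left hpow (by positivity))
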